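/- **Theorem 2.1.** Let $Y$ be a complex Banach space, $n\in\mathbb N$, $k\ge 0$, $w(x)=(1+\|x\|)^k$ for $x\in\mathbb R^n$ ($\|\cdot\|$ the Euclidean norm), and let $X$ be one of the spaces $BUC(\mathbb R^n,Y)$ (bounded uniformly continuous functions), $C_0(\mathbb R^n,Y)$ (continuous functions vanishing at infinity), both with the sup norm, or $L^p(\mathbb R^n,Y)$ with $1\le p<\infty$. Let $wX=\{wg : g\in X\}$ with the norm $\|f\|_{wX}=\|f/w\|_X$, regarded as a subspace of the space $\mathcal S'(\mathbb R^n,Y)$ of $Y$-valued tempered distributions. For $\operatorname{Re}\zeta>0$ let $$\chi_\zeta(x)=(4\pi\zeta)^{-n/2}e^{-\|x\|^2/(4\zeta)},$$ with the principal branch of the power. Then for all $\operatorname{Re}\zeta>0$ and $f\in wX$ the Bochner integral $$(G(\zeta)f)(x)=\int_{\mathbb R^n}\chi_\zeta(y)f(x-y)\,dy$$ exists for every $x\in\mathbb R^n$, and $G(\zeta)$ is a bounded linear operator on $wX$. With $G(0)=I$, $G$ is a holomorphic $C_0$-semigroup of angle $\pi/2$ on $wX$, that is: * $G(\zeta_1+\zeta_2)=G(\zeta_1)G(\zeta_2)$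 for $\operatorname{Re}\zeta_1,\operatorname{Re}\zeta_2>0$, and $(G(t))_{t\ge 0}$ is a $C_0$-semigroup; * $\zeta\mapsto G(\zeta)$ is holomorphic on $\{\operatorname{Re}\zeta>0\}$ for the operator norm; * for every $0<\alpha<\pi/2$, $\|G(\zeta)\|$ is bounded on $\{\zeta\neq 0: |\arg\zeta|<\alpha,\ |\zeta|\le 1\}$, and for every $f\in wX$, $G(\zeta)f\to f$ in $wX$ as $\zeta\to 0$ with $\zeta\ne 0$, $|\arg\zeta|<\alpha$. The generator of $(G(t))_{t\ge 0}$ is the distributional Laplacian $\Delta=\sum_{j=1}^n\partial^2/\partial x_j^2$ on $wX$ with domain $\{f\in wX : \Delta f\in wX\}$. -/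

import Mathlib

open MeasureTheory Filter Topology Set
open scoped ENNReal SchwartzMap Laplacian BoundedContinuousFunction ZeroAtInfty

noncomputable section

namespace WeightedHeat

/-! ### Holomorphic semigroups and their generators -/

section Semigroup

/-- The open sector `{z ≠ 0 : |arg z| < θ}`. -/
def sector (θ : ℝ) : Set ℂ := {z | z ≠ 0 ∧ |Complex.arg z| < θ}

variable {Z : Type*} [NormedAddCommGroup Z] [NormedSpace ℂ Z]

/-- `T` restricted to `[0, ∞)` is a `C₀`-semigroup of bounded operators (values at negative times
are irrelevant). -/
structure IsC0Semigroup (T : ℝ → Z →L[ℂ] Z) : Prop where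
  map_zero : T 0 = ContinuousLinearMap.id ℂ Z
  map_add : ∀ s t : ℝ, 0 ≤ s → 0 ≤ t → T (s + t) = (T s).comp (T t)
  strongly_continuous : ∀ f : Z, ContinuousOn (fun t => T t f) (Ici 0)

/-- `G` is a holomorphic `C₀`-semigroup of angle `θ` (for `0 < θ ≤ π / 2`): on `[0, ∞)` it is a
`C₀`-semigroup, on the open sector of angle `θ` it is holomorphic for the operator norm and
satisfies the semigroup law, and on each smaller sector it is bounded near the origin and converges
strongly to the identity at the origin. Values outside the sector and `0` are irrelevant. -/
structure IsHolomorphicC0Semigroup (θ : ℝ) (G : ℂ → Z →L[ℂ] Z) : Prop where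
  isC0Semigroup : IsC0Semigroup (fun t : ℝ => G (t : ℂ))
  holomorphic : DifferentiableOn ℂ G (sector θ)
  map_add : ∀ z₁ ∈ sector θ, ∀ z₂ ∈ sector θ, G (z₁ + z₂) = (G z₁).comp (G z₂)
  bounded : ∀ α : ℝ, 0 < α → α < θ → ∃ M : ℝ, ∀ z ∈ sector α, ‖z‖ ≤ 1 → ‖G z‖ ≤ M
  tendsto_zero : ∀ α : ℝ, 0 < α → α < θ → ∀ f : Z, Tendsto (fun z => G z f) (𝓝[sector α] 0) (𝓝 f)

/-- The graph of the generator `A` of `T`: `IsGeneratorAt T f h` says that `f ∈ D(A)` and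
`A f = h`, that is, `(T t f - f) / t → h` as `t ↓ 0`. -/
def IsGeneratorAt (T : ℝ → Z →L[ℂ] Z) (f h : Z) : Prop :=
  Tendsto (fun t : ℝ => ((t⁻¹ : ℝ) : ℂ) • (T t f - f)) (𝓝[>] 0) (𝓝 h)

end Semigroup

/-! ### The image of a Banach space under an injective linear map, with the norm carried over -/

section NormedImage

variable {X F : Type*} [NormedAddCommGroup X] [NormedSpace ℂ X] [AddCommGroup F] [Module ℂ F]

/-- The linear subspace `{T g : g ∈ X}` of `F`, with the norm `‖T g‖ = ‖g‖`. -/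
def NormedImage (T : X →ₗ[ℂ] F) (_hT : Function.Injective T) : Type _ := ↥(LinearMap.range T)

namespace NormedImage

variable (T : X →ₗ[ℂ] F) (hT : Function.Injective T)

instance : AddCommGroup (NormedImage T hT) := inferInstanceAs (AddCommGroup ↥(LinearMap.range T))

instance : Module ℂ (NormedImage T hT) := inferInstanceAs (Module ℂ ↥(LinearMap.range T))

/-- The bijection `g ↦ T g` from `X` onto the image. -/
def equiv : X ≃ₗ[ℂ] NormedImage T hT := LinearEquiv.ofInjective T hT

/-- The inclusion of the image into `F`. -/
def incl : NormedImage T hT →ₗ[ℂ] F := (LinearMap.range T).subtype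

instance : NormedAddCommGroup (NormedImage T hT) :=
  NormedAddCommGroup.induced (NormedImage T hT) X (equiv T hT).symm.toLinearMap
    (equiv T hT).symm.injective

instance : NormedSpace ℂ (NormedImage T hT) :=
  NormedSpace.induced ℂ (NormedImage T hT) X (equiv T hT).symm.toLinearMap

theorem incl_equiv (g : X) : incl T hT (equiv T hT g) = T g := rfl

theorem incl_injective : Function.Injective (incl T hT) :=
  (LinearMap.range T).injective_subtype

theorem norm_equiv (g : X) : ‖equiv T hT g‖ = ‖g‖ := by
  change ‖(equiv T hT).symm (equiv T hT g)‖ = ‖g‖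
  rw [LinearEquiv.symm_apply_apply]

theorem exists_eq (f : NormedImage T hT) : ∃ g : X, incl T hT f = T g := by
  obtain ⟨g, rfl⟩ := (equiv T hT).surjective f
  exact ⟨g, rfl⟩

/-- `equiv` as a linear isometry. -/
def isometryEquiv : X ≃ₗᵢ[ℂ] NormedImage T hT := ⟨equiv T hT, norm_equiv T hT⟩

instance [CompleteSpace X] : CompleteSpace (NormedImage T hT) :=
  (completeSpace_congr (e := (isometryEquiv T hT).toEquiv)
    (isometryEquiv T hT).isometry.isUniformEmbedding).1 inferInstance

end NormedImage

end NormedImage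

/-! ### The weighted spaces `w X` -/

section Spaces

/-- `ℝⁿ` with the Euclidean norm. -/
abbrev E (n : ℕ) : Type := EuclideanSpace ℝ (Fin n)

variable {n : ℕ}

/-- The weight `w(x) = (1 + ‖x‖) ^ k`. -/
def weight (k : ℝ) (x : E n) : ℝ := (1 + ‖x‖) ^ k

theorem weight_pos (k : ℝ) (x : E n) : 0 < weight k x := by unfold weight; positivity

theorem continuous_weight (k : ℝ) : Continuous (weight k : E n → ℝ) := by
  unfold weight
  exact (continuous_const.add continuous_norm).rpow_const
    fun x => Or.inl (by positivity : (0 : ℝ) < 1 + ‖x‖).ne'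

variable (n) (k : ℝ) (Y : Type*) [NormedAddCommGroup Y] [NormedSpace ℂ Y]

/-- The bounded uniformly continuous functions `ℝⁿ → Y`, with the sup norm. -/
def BUC : Submodule ℂ (E n →ᵇ Y) where
  carrier := {f | UniformContinuous f}
  add_mem' hf hg := hf.add hg
  zero_mem' := uniformContinuous_const
  smul_mem' c _ hf := hf.const_smul c

theorem isClosed_BUC : IsClosed (BUC n Y : Set (E n →ᵇ Y)) := by
  refine isClosed_of_closure_subset fun f hf => ?_
  obtain ⟨u, hu, hlim⟩ := mem_closure_iff_seq_limit.1 hf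
  exact (BoundedContinuousFunction.tendsto_iff_tendstoUniformly.1 hlim).uniformContinuous
    (Eventually.frequently (Eventually.of_forall hu))

instance [CompleteSpace Y] : CompleteSpace (BUC n Y) :=
  (isClosed_BUC n Y).completeSpace_coe

/-- `g ↦ w g` on bounded uniformly continuous functions. -/
def mulWeightBUC : BUC n Y →ₗ[ℂ] (E n → Y) where
  toFun g x := weight k x • g.1 x
  map_add' f g := by ext x; simp
  map_smul' c g := by ext x; exact smul_comm _ _ _

theorem mulWeightBUC_injective : Function.Injective (mulWeightBUC n k Y) := by
  intro f g h
  ext x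
  exact smul_right_injective Y (weight_pos k x).ne' (congrFun h x)

/-- `w BUC(ℝⁿ, Y) = {w g : g ∈ BUC(ℝⁿ, Y)}` with the norm `‖f‖ = sup ‖f / w‖`. -/
abbrev WBUC : Type _ := NormedImage (mulWeightBUC n k Y) (mulWeightBUC_injective n k Y)

/-- `g ↦ w g` on continuous functions vanishing at infinity. -/
def mulWeightC0 : C₀(E n, Y) →ₗ[ℂ] (E n → Y) where
  toFun g x := weight k x • g x
  map_add' f g := by ext x; simp
  map_smul' c g := by ext x; exact smul_comm _ _ _

theorem mulWeightC0_injective : Function.Injective (mulWeightC0 n k Y) := by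
  intro f g h
  ext x
  exact smul_right_injective Y (weight_pos k x).ne' (congrFun h x)

/-- `w C₀(ℝⁿ, Y) = {w g : g ∈ C₀(ℝⁿ, Y)}` with the norm `‖f‖ = sup ‖f / w‖`. -/
abbrev WC0 : Type _ := NormedImage (mulWeightC0 n k Y) (mulWeightC0_injective n k Y)

variable (p : ℝ≥0∞)

/-- `g ↦ w g` on `Lᵖ`, with values in the almost everywhere classes of strongly measurable
functions. -/
def mulWeightLp : Lp Y p (volume : Measure (E n)) →ₗ[ℂ] (E n →ₘ[volume] Y) where
  toFun g := AEEqFun.mk (fun x => weight k x • g x)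
    ((continuous_weight k).aestronglyMeasurable.smul (Lp.aestronglyMeasurable g))
  map_add' f g := by
    refine Eq.trans (AEEqFun.mk_eq_mk.2 ?_) (AEEqFun.mk_add_mk _ _ _ _).symm
    filter_upwards [Lp.coeFn_add f g] with x hx
    rw [hx]
    exact smul_add _ _ _
  map_smul' c g := by
    refine Eq.trans (AEEqFun.mk_eq_mk.2 ?_) (AEEqFun.smul_mk c (fun x => weight k x • g x)
      ((continuous_weight k).aestronglyMeasurable.smul (Lp.aestronglyMeasurable g))).symm
    filter_upwards [Lp.coeFn_smul c g] with x hx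
    rw [hx]
    exact smul_comm _ _ _

theorem mulWeightLp_injective : Function.Injective (mulWeightLp n k Y p) := by
  intro f g h
  refine Lp.ext ?_
  filter_upwards [AEEqFun.mk_eq_mk.1 h] with x hx
  exact smul_right_injective Y (weight_pos k x).ne' hx

/-- `w Lᵖ(ℝⁿ, Y) = {w g : g ∈ Lᵖ(ℝⁿ, Y)}` with the norm `‖f‖ = ‖f / w‖_p`. -/
abbrev WLp [Fact (1 ≤ p)] : Type _ := NormedImage (mulWeightLp n k Y p) (mulWeightLp_injective n k Y p)

variable {n k Y p}

instance : CoeFun (WBUC n k Y) (fun _ => E n → Y) :=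
  ⟨NormedImage.incl (mulWeightBUC n k Y) (mulWeightBUC_injective n k Y)⟩

instance : CoeFun (WC0 n k Y) (fun _ => E n → Y) :=
  ⟨NormedImage.incl (mulWeightC0 n k Y) (mulWeightC0_injective n k Y)⟩

/-- An element of `w Lᵖ` is used as a function through a representative of its class. -/
instance [Fact (1 ≤ p)] : CoeFun (WLp n k Y p) (fun _ => E n → Y) :=
  ⟨fun f => (NormedImage.incl (mulWeightLp n k Y p) (mulWeightLp_injective n k Y p) f :
    E n →ₘ[volume] Y)⟩

end Spaces

/-! ### Functions as tempered distributions -/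

section Distributions

variable {n : ℕ} {Y : Type*} [NormedAddCommGroup Y] [NormedSpace ℂ Y]

/-- `f` is integrable after division by some power of `1 + ‖x‖`. -/
def PolyIntegrable (f : E n → Y) : Prop :=
  ∃ N : ℕ, Integrable fun x => ((1 + ‖x‖) ^ N)⁻¹ • f x

theorem PolyIntegrable.norm_smul_le {N : ℕ} (f : E n → Y) (ψ : 𝓢(E n, ℂ)) (x : E n) :
    ‖ψ x • f x‖ ≤ ‖((1 + ‖x‖) ^ N)⁻¹ • f x‖ *
      (2 ^ N * ((Finset.Iic (N, 0)).sup (schwartzSeminormFamily ℂ (E n) ℂ)) ψ) := by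
  have h : (1 + ‖x‖) ^ N * ‖ψ x‖ ≤
      2 ^ N * ((Finset.Iic (N, 0)).sup (schwartzSeminormFamily ℂ (E n) ℂ)) ψ := by
    have h' := SchwartzMap.one_add_le_sup_seminorm_apply (𝕜 := ℂ) (m := (N, 0)) (k := N) (n := 0)
      le_rfl le_rfl ψ x
    rw [norm_iteratedFDeriv_zero] at h'
    exact h'
  have hpos : 0 < (1 + ‖x‖) ^ N := by positivity
  rw [norm_smul, norm_smul, norm_inv, Real.norm_of_nonneg hpos.le]
  calc ‖ψ x‖ * ‖f x‖ = ((1 + ‖x‖) ^ N)⁻¹ * ‖f x‖ * ((1 + ‖x‖) ^ N * ‖ψ x‖) := by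
        field_simp
    _ ≤ _ := by gcongr

theorem PolyIntegrable.integrable_smul {f : E n → Y} (hf : PolyIntegrable f) (ψ : 𝓢(E n, ℂ)) :
    Integrable fun x => ψ x • f x := by
  obtain ⟨N, hN⟩ := hf
  have hmeas : AEStronglyMeasurable f volume := by
    have h1 : Continuous fun x : E n => (1 + ‖x‖) ^ N := by fun_prop
    refine (h1.aestronglyMeasurable.smul hN.aestronglyMeasurable).congr (.of_forall fun x => ?_)
    have hpos : (1 + ‖x‖) ^ N ≠ 0 := by positivity
    simp [smul_smul, hpos]
  exact (hN.norm.mul_const _).mono' (ψ.continuous.aestronglyMeasurable.smul hmeas)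
    (.of_forall fun x => PolyIntegrable.norm_smul_le f ψ x)

/-- The tempered distribution `ψ ↦ ∫ ψ f` of a function `f`. -/
def toTempered (f : E n → Y) (hf : PolyIntegrable f) : 𝓢'(E n, Y) :=
  ContinuousLinearMap.toPointwiseConvergenceCLM _ _ _ _ <|
    SchwartzMap.mkCLMtoNormedSpace (𝕜 := ℂ) (σ := RingHom.id ℂ)
      (fun ψ : 𝓢(E n, ℂ) => ∫ x, ψ x • f x)
      (fun φ ψ => by
        rw [← integral_add (hf.integrable_smul φ) (hf.integrable_smul ψ)]
        simp [add_smul])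
      (fun a ψ => by
        rw [RingHom.id_apply, ← integral_smul]
        simp [smul_smul])
      (by
        obtain ⟨N, hN⟩ := hf
        refine ⟨Finset.Iic (N, 0), (∫ x, ‖((1 + ‖x‖) ^ N)⁻¹ • f x‖) * 2 ^ N, by positivity,
          fun ψ => ?_⟩
        refine (norm_integral_le_of_norm_le (hN.norm.mul_const _)
          (.of_forall fun x => PolyIntegrable.norm_smul_le f ψ x)).trans_eq ?_
        rw [integral_mul_const, mul_assoc])

theorem toTempered_apply (f : E n → Y) (hf : PolyIntegrable f) (ψ : 𝓢(E n, ℂ)) :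
    toTempered f hf ψ = ∫ x, ψ x • f x := rfl

theorem polyIntegrable_of_le {k : ℝ} {f : E n → Y} (hf : AEStronglyMeasurable f volume)
    {C : ℝ} {u : E n → ℝ} (hu : Integrable u)
    (h : ∀ᵐ x, ‖f x‖ ≤ weight k x * (C + u x)) : PolyIntegrable f := by
  obtain ⟨N, hN⟩ := exists_nat_gt (|k| + n + 1)
  refine ⟨N, ?_⟩
  have hr : (Module.finrank ℝ (E n) : ℝ) < (n : ℝ) + 1 := by simp
  have hint := (integrable_one_add_norm (μ := (volume : Measure (E n))) hr).const_mul |C|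
  have hcont : Continuous fun x : E n => ((1 + ‖x‖) ^ N)⁻¹ :=
    (by fun_prop : Continuous fun x : E n => (1 + ‖x‖) ^ N).inv₀ fun x => by positivity
  refine (hint.add hu.norm).mono' (hcont.aestronglyMeasurable.smul hf) ?_
  filter_upwards [h] with x hx
  have h1 : (1 : ℝ) ≤ 1 + ‖x‖ := by simp
  have h0 : (0 : ℝ) < 1 + ‖x‖ := by positivity
  have hk : ((1 + ‖x‖) ^ N)⁻¹ * weight k x ≤ (1 + ‖x‖) ^ (-((n : ℝ) + 1)) := by
    rw [weight, ← Real.rpow_natCast, ← Real.rpow_neg h0.le, ← Real.rpow_add h0]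
    refine Real.rpow_le_rpow_of_exponent_le h1 ?_
    linarith [le_abs_self k]
  have hk1 : (1 + ‖x‖) ^ (-((n : ℝ) + 1)) ≤ 1 :=
    Real.rpow_le_one_of_one_le_of_nonpos h1 (by linarith [(Nat.cast_nonneg n : (0 : ℝ) ≤ n)])
  have hw := weight_pos k x
  rw [norm_smul, norm_inv, Real.norm_of_nonneg (by positivity : 0 ≤ (1 + ‖x‖) ^ N)]
  calc ((1 + ‖x‖) ^ N)⁻¹ * ‖f x‖ ≤ ((1 + ‖x‖) ^ N)⁻¹ * (weight k x * (|C| + ‖u x‖)) := by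
        gcongr
        refine hx.trans ?_
        gcongr
        · exact le_abs_self C
        · exact le_abs_self (u x)
    _ = (((1 + ‖x‖) ^ N)⁻¹ * weight k x) * (|C| + ‖u x‖) := by ring
    _ ≤ (1 + ‖x‖) ^ (-((n : ℝ) + 1)) * (|C| + ‖u x‖) := by gcongr
    _ = |C| * (1 + ‖x‖) ^ (-((n : ℝ) + 1)) + (1 + ‖x‖) ^ (-((n : ℝ) + 1)) * ‖u x‖ := by ring
    _ ≤ |C| * (1 + ‖x‖) ^ (-((n : ℝ) + 1)) + ‖u x‖ := by
        gcongr
        exact mul_le_of_le_one_left (norm_nonneg _) hk1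

variable {k : ℝ} {p : ℝ≥0∞} [Fact (1 ≤ p)]

theorem polyIntegrable_WBUC (f : WBUC n k Y) : PolyIntegrable f := by
  obtain ⟨g, hg⟩ := NormedImage.exists_eq _ _ f
  rw [hg]
  refine polyIntegrable_of_le (k := k) (C := ‖g.1‖) (u := 0)
    (((continuous_weight k).smul g.1.continuous).aestronglyMeasurable) (integrable_zero _ _ _)
    (.of_forall fun x => ?_)
  change ‖weight k x • g.1 x‖ ≤ _
  rw [norm_smul, Real.norm_of_nonneg (weight_pos k x).le]
  gcongr
  · exact (weight_pos k x).le
  · simpa using g.1.norm_coe_le_norm x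

theorem polyIntegrable_WC0 (f : WC0 n k Y) : PolyIntegrable f := by
  obtain ⟨g, hg⟩ := NormedImage.exists_eq _ _ f
  rw [hg]
  refine polyIntegrable_of_le (k := k) (C := ‖g.toBCF‖) (u := 0)
    (((continuous_weight k).smul g.continuous).aestronglyMeasurable) (integrable_zero _ _ _)
    (.of_forall fun x => ?_)
  change ‖weight k x • g x‖ ≤ _
  rw [norm_smul, Real.norm_of_nonneg (weight_pos k x).le]
  gcongr
  · exact (weight_pos k x).le
  · simpa using g.toBCF.norm_coe_le_norm x

theorem polyIntegrable_WLp (hp : p ≠ ∞) (f : WLp n k Y p) : PolyIntegrable f := by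
  obtain ⟨g, hg⟩ := NormedImage.exists_eq _ _ f
  have hp1 : (1 : ℝ≥0∞) ≤ p := Fact.out
  have hp0 : p ≠ 0 := (zero_lt_one.trans_le hp1).ne'
  refine polyIntegrable_of_le (k := k) (C := 1) (AEEqFun.aestronglyMeasurable _)
    ((Lp.memLp g).integrable_norm_rpow hp0 hp) ?_
  rw [hg]
  filter_upwards [AEEqFun.coeFn_mk (fun x => weight k x • g x)
    ((continuous_weight k).aestronglyMeasurable.smul (Lp.aestronglyMeasurable g))] with x hx
  have hx' : (mulWeightLp n k Y p g) x = weight k x • g x := hx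
  rw [hx', norm_smul, Real.norm_of_nonneg (weight_pos k x).le]
  gcongr
  · exact (weight_pos k x).le
  · have hq : 1 ≤ p.toReal := by
      simpa using ENNReal.toReal_mono hp hp1
    rcases le_total ‖g x‖ 1 with h | h
    · have : 0 ≤ ‖g x‖ ^ p.toReal := by positivity
      linarith
    · have := Real.rpow_le_rpow_of_exponent_le h hq
      rw [Real.rpow_one] at this
      linarith

/-- The tempered distribution of an element of `w BUC`. -/
def distBUC (f : WBUC n k Y) : 𝓢'(E n, Y) := toTempered f (polyIntegrable_WBUC f)

/-- The tempered distribution of an element of `w C₀`. -/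
def distC0 (f : WC0 n k Y) : 𝓢'(E n, Y) := toTempered f (polyIntegrable_WC0 f)

/-- The tempered distribution of an element of `w Lᵖ`, `1 ≤ p < ∞`. -/
def distLp (hp : p ≠ ∞) (f : WLp n k Y p) : 𝓢'(E n, Y) := toTempered f (polyIntegrable_WLp hp f)

/-- The graph of the maximal distributional Laplacian on a space `Z` of functions that embeds into
the tempered distributions by `ι`: `f` is in the domain `{f ∈ Z : Δ f ∈ Z}`, and `Δ f = h`. -/
def IsLaplacianAt {Z : Type*} (ι : Z → 𝓢'(E n, Y)) (f h : Z) : Prop := Δ (ι f) = ι h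

end Distributions

/-! ### The Gauss-Poisson convolution -/

section Gauss

variable {n : ℕ} {Y : Type*} [NormedAddCommGroup Y] [NormedSpace ℂ Y]

/-- The Gauss kernel `χ_ζ(x) = (4 π ζ) ^ (-n / 2) exp (-‖x‖² / (4 ζ))`, with the principal branch
of the power. -/
def gaussKernel (ζ : ℂ) (x : E n) : ℂ :=
  (4 * Real.pi * ζ) ^ (-(n : ℂ) / 2) * Complex.exp (-((‖x‖ ^ 2 : ℝ) : ℂ) / (4 * ζ))

/-- `(χ_ζ * f)(x) = ∫ χ_ζ(y) f(x - y) dy`. -/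
def gaussConv (ζ : ℂ) (f : E n → Y) (x : E n) : Y := ∫ y, gaussKernel ζ y • f (x - y)

/-- The integral that defines `(χ_ζ * f)(x)` exists as a Bochner integral. -/
def GaussConvExistsAt (ζ : ℂ) (f : E n → Y) (x : E n) : Prop :=
  Integrable fun y => gaussKernel ζ y • f (x - y)

end Gauss

end WeightedHeat

end

open WeightedHeat

/-!
All three spaces `Z = w X` carry the translations `(U y f)(x) = f (x - y)`. They form a strongly
continuous representation of `ℝⁿ` with `‖U y‖ ≤ w y`, because `w (x + y) ≤ w x * w y`
(`IsWeightedTranslation`). The convolution with a function `a` in `L¹(ℝⁿ, w dy)` is then the Bochner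
integral `∫ a(y) U(y) f dy` in `Z`. This defines bounded operators, of norm at most the weighted `L¹`
norm of `a`, and turns the convolution of kernels into the composition of operators
(`IsWeightedTranslation.convOp_comp`). So the semigroup properties of `G(ζ) f = ∫ χ_ζ(y) U(y) f dy`
reduce to facts about the Gauss kernels in the weighted `L¹` space: the identity
`χ_z * χ_w = χ_{z + w}` by completing the square (`integral_gaussKernel_mul`), the differentiability
of `ζ ↦ χ_ζ` by dominated convergence, and, on sectors, the domination of `χ_ζ` by one rescaled Gauss
function (`norm_gaussKernel_le_sectorMajorant`), which gives the boundedness near the origin and the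
strong convergence to the identity.

For the generator, elements of `Z` are paired with Schwartz functions `ψ` (`IsFunctionRealization`).
For `s > 0` the derivative of `χ_s` in `s` is `Δ χ_s`, and integration by parts moves the Laplacian
to the test function, so that `⟨G(s) f, ψ⟩` has the derivative `⟨G(s) f, Δ ψ⟩`
(`IsFunctionRealization.hasDerivAt_pairing`). If `(G(t) f - f) / t → h`, letting `s ↓ 0` gives
`⟨f, Δ ψ⟩ = ⟨h, ψ⟩`. Conversely, if `Δ f = h` in the sense of distributions, then
`⟨G(s) f, Δ ψ⟩ = ⟨G(s) h, ψ⟩` because translations commute with `Δ`. Integration in `s` gives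
`G(t) f - f = ∫₀ᵗ G(s) h ds` in `Z`, and hence `(G(t) f - f) / t → h`.

In `w BUC` and `w C₀` evaluation at a point is continuous and identifies the Bochner integral with
the pointwise convolution. In `w Lᵖ` the two are compared by testing against Schwartz functions and
Fubini's theorem (`IsFunctionRealization.ae_eq_gaussConv`).
-/

open MeasureTheory Filter Topology Set
open scoped ENNReal SchwartzMap Laplacian BoundedContinuousFunction ZeroAtInfty

noncomputable section

namespace WeightedHeat

/-! ### The Gauss kernel -/

section Kernel

variable {n : ℕ}

theorem one_add_pow_mul_exp_le {c : ℝ} (hc : 0 < c) (N : ℕ) :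
    ∃ C : ℝ, ∀ r : ℝ, 0 ≤ r → (1 + r) ^ N * Real.exp (-c * r ^ 2) ≤ C := by
  refine ⟨N.factorial * Real.exp (1 + 1 / (4 * c)), fun r hr => ?_⟩
  have h1 : (1 + r) ^ N ≤ N.factorial * Real.exp (1 + r) := by
    have := Real.pow_div_factorial_le_exp (1 + r) (by positivity) N
    rwa [div_le_iff₀' (by positivity)] at this
  have h2 : (1 + r) + -c * r ^ 2 ≤ 1 + 1 / (4 * c) := by
    have : 1 / (4 * c) - r + c * r ^ 2 = (2 * c * r - 1) ^ 2 / (4 * c) := by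
      field_simp
      ring
    have : 0 ≤ (2 * c * r - 1) ^ 2 / (4 * c) := by positivity
    linarith
  calc (1 + r) ^ N * Real.exp (-c * r ^ 2)
      ≤ N.factorial * Real.exp (1 + r) * Real.exp (-c * r ^ 2) := by gcongr
    _ = N.factorial * Real.exp ((1 + r) + -c * r ^ 2) := by rw [Real.exp_add _ (-c * r ^ 2)]; ring
    _ ≤ _ := by gcongr

/-- Continuous functions on `ℝⁿ` that decay faster than every power of `1 + ‖y‖`. -/
structure RapidDecay {F : Type*} [NormedAddCommGroup F] (a : E n → F) : Prop where
  continuous : Continuous a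
  bound : ∀ N : ℕ, ∃ C : ℝ, ∀ y, (1 + ‖y‖) ^ N * ‖a y‖ ≤ C

/-- Gauss functions times powers decay rapidly. -/
theorem RapidDecay.of_gauss_bound {F : Type*} [NormedAddCommGroup F] {a : E n → F}
    (ha : Continuous a) {c C : ℝ} (hc : 0 < c) (M : ℕ)
    (h : ∀ y, ‖a y‖ ≤ C * (1 + ‖y‖) ^ M * Real.exp (-c * ‖y‖ ^ 2)) : RapidDecay a := by
  refine ⟨ha, fun N => ?_⟩
  obtain ⟨D, hD⟩ := one_add_pow_mul_exp_le hc (N + M)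
  refine ⟨|C| * D, fun y => ?_⟩
  calc (1 + ‖y‖) ^ N * ‖a y‖
      ≤ (1 + ‖y‖) ^ N * (|C| * (1 + ‖y‖) ^ M * Real.exp (-c * ‖y‖ ^ 2)) := by
        gcongr
        refine (h y).trans ?_
        gcongr
        exact le_abs_self C
    _ = |C| * ((1 + ‖y‖) ^ (N + M) * Real.exp (-c * ‖y‖ ^ 2)) := by rw [pow_add]; ring
    _ ≤ |C| * D := by
        gcongr
        exact hD _ (norm_nonneg _)

theorem RapidDecay.integrable_pow {F : Type*} [NormedAddCommGroup F]
    {a : E n → F} (ha : RapidDecay a) (N : ℕ) :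
    Integrable fun y => (1 + ‖y‖) ^ N * ‖a y‖ := by
  obtain ⟨C, hC⟩ := ha.bound (N + (n + 1))
  have hr : (Module.finrank ℝ (E n) : ℝ) < (n : ℝ) + 1 := by simp
  have hint := (integrable_one_add_norm (μ := (volume : Measure (E n))) hr).const_mul C
  have hcont : Continuous fun y : E n => (1 + ‖y‖) ^ N * ‖a y‖ :=
    (by fun_prop : Continuous fun y : E n => (1 + ‖y‖) ^ N).mul ha.continuous.norm
  refine hint.mono' hcont.aestronglyMeasurable (.of_forall fun y => ?_)
  have h0 : (0 : ℝ) < 1 + ‖y‖ := by positivity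
  rw [Real.norm_of_nonneg (by positivity), Real.rpow_neg h0.le, ← div_eq_mul_inv,
    le_div_iff₀ (by positivity)]
  have h2 : (1 + ‖y‖) ^ ((n : ℝ) + 1) = (1 + ‖y‖) ^ (n + 1) := by
    rw [← Real.rpow_natCast]; norm_cast
  rw [h2]
  calc _ = (1 + ‖y‖) ^ (N + (n + 1)) * ‖a y‖ := by rw [pow_add]; ring
    _ ≤ C := hC y

theorem one_le_weight {k : ℝ} (hk : 0 ≤ k) (y : E n) : 1 ≤ weight k y :=
  Real.one_le_rpow (by simp) hk

theorem weight_smul_le {k : ℝ} (hk : 0 ≤ k) {r : ℝ} (hr0 : 0 ≤ r) (hr1 : r ≤ 1) (y : E n) :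
    weight k (r • y) ≤ weight k y := by
  refine Real.rpow_le_rpow (by positivity) ?_ hk
  rw [norm_smul, Real.norm_of_nonneg hr0]
  gcongr
  exact mul_le_of_le_one_left (norm_nonneg _) hr1

theorem weight_le_pow (k : ℝ) (y : E n) : weight k y ≤ (1 + ‖y‖) ^ ⌈|k|⌉₊ := by
  rw [weight, ← Real.rpow_natCast]
  refine Real.rpow_le_rpow_of_exponent_le (by simp) ?_
  exact (le_abs_self k).trans (Nat.le_ceil _)

theorem RapidDecay.integrable_weight {F : Type*} [NormedAddCommGroup F]
    {a : E n → F} (ha : RapidDecay a) (k : ℝ) :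
    Integrable fun y => weight k y * ‖a y‖ := by
  refine (ha.integrable_pow ⌈|k|⌉₊).mono'
    ((continuous_weight k).mul ha.continuous.norm).aestronglyMeasurable (.of_forall fun y => ?_)
  rw [Real.norm_of_nonneg (mul_nonneg (weight_pos k y).le (norm_nonneg _))]
  gcongr
  exact weight_le_pow k y

theorem RapidDecay.integrable {F : Type*} [NormedAddCommGroup F] {a : E n → F}
    (ha : RapidDecay a) : Integrable a := by
  refine (integrable_norm_iff ha.continuous.aestronglyMeasurable).1 ?_
  simpa using ha.integrable_pow 0

variable {ζ : ℂ}

theorem norm_gaussKernel (hζ : 0 < ζ.re) (y : E n) :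
    ‖gaussKernel ζ y‖ = (4 * Real.pi * ‖ζ‖) ^ (-(n : ℝ) / 2) *
      Real.exp (-(ζ.re / (4 * ‖ζ‖ ^ 2)) * ‖y‖ ^ 2) := by
  have h1 : (-(n : ℂ) / 2) = ((-(n : ℝ) / 2 : ℝ) : ℂ) := by push_cast; ring
  rw [gaussKernel, norm_mul, h1, Complex.norm_cpow_real, Complex.norm_exp]
  congr 2
  · simp [abs_of_pos Real.pi_pos]
  · have : -((‖y‖ ^ 2 : ℝ) : ℂ) / (4 * ζ) = ((-‖y‖ ^ 2 / 4 : ℝ) : ℂ) * ζ⁻¹ := by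
      push_cast
      rw [div_eq_mul_inv, mul_inv]
      ring
    rw [this, Complex.re_ofReal_mul, Complex.inv_re, Complex.normSq_eq_norm_sq]
    have : ‖ζ‖ ≠ 0 := by
      rw [norm_ne_zero_iff]
      rintro rfl
      simp at hζ
    field_simp

theorem gaussKernel_eq_exp (hζ : ζ ≠ 0) (y : E n) :
    gaussKernel ζ y = Complex.exp (Complex.log (4 * Real.pi * ζ) * (-(n : ℂ) / 2) +
      -((‖y‖ ^ 2 : ℝ) : ℂ) / (4 * ζ)) := by
  rw [gaussKernel, Complex.cpow_def_of_ne_zero, Complex.exp_add]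
  simp [hζ, Real.pi_ne_zero]

theorem continuous_gaussKernel (ζ : ℂ) : Continuous (gaussKernel ζ : E n → ℂ) := by
  unfold gaussKernel
  fun_prop

theorem ne_zero_of_re_pos (hζ : 0 < ζ.re) : ζ ≠ 0 := by
  rintro rfl
  simp at hζ

theorem rapidDecay_gaussKernel (hζ : 0 < ζ.re) : RapidDecay (gaussKernel ζ : E n → ℂ) := by
  have hn := norm_pos_iff.2 (ne_zero_of_re_pos hζ)
  refine .of_gauss_bound (C := (4 * Real.pi * ‖ζ‖) ^ (-(n : ℝ) / 2)) (continuous_gaussKernel ζ)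
    (by positivity : 0 < ζ.re / (4 * ‖ζ‖ ^ 2)) 0 fun y => ?_
  rw [pow_zero, mul_one]
  exact (norm_gaussKernel hζ y).le

/-- The derivative of the Gauss kernel `χ_ζ(y)` in the variable `ζ`. -/
def gaussKernelDeriv (ζ : ℂ) (y : E n) : ℂ :=
  (((‖y‖ ^ 2 : ℝ) : ℂ) / (4 * ζ ^ 2) - n / (2 * ζ)) * gaussKernel ζ y

theorem continuous_gaussKernelDeriv (ζ : ℂ) : Continuous (gaussKernelDeriv ζ : E n → ℂ) := by
  have := continuous_gaussKernel (n := n) ζ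
  unfold gaussKernelDeriv
  fun_prop

theorem hasDerivAt_gaussKernel (hζ : 0 < ζ.re) (y : E n) :
    HasDerivAt (fun z => gaussKernel z y) (gaussKernelDeriv ζ y) ζ := by
  have h0 := ne_zero_of_re_pos hζ
  have hs : 4 * Real.pi * ζ ∈ Complex.slitPlane := by
    left
    have : (4 * (Real.pi : ℂ) * ζ) = ((4 * Real.pi : ℝ) : ℂ) * ζ := by push_cast; ring
    rw [this, Complex.re_ofReal_mul]
    positivity
  have h1 : HasDerivAt (fun z : ℂ => 4 * (Real.pi : ℂ) * z) (4 * Real.pi) ζ := by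
    simpa using (hasDerivAt_id ζ).const_mul (4 * (Real.pi : ℂ))
  have h2 : HasDerivAt (fun z : ℂ => -((‖y‖ ^ 2 : ℝ) : ℂ) / (4 * z))
      (((‖y‖ ^ 2 : ℝ) : ℂ) / (4 * ζ ^ 2)) ζ := by
    have h4 : HasDerivAt (fun z : ℂ => 4 * z) 4 ζ := by
      simpa using (hasDerivAt_id ζ).const_mul (4 : ℂ)
    refine ((hasDerivAt_const ζ (-((‖y‖ ^ 2 : ℝ) : ℂ))).div h4 (by simp [h0])).congr_deriv ?_
    field_simp
    ring
  have h3 := (((h1.clog hs).mul_const (-(n : ℂ) / 2)).add h2).cexp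
  refine (h3.congr_of_eventuallyEq ?_).congr_deriv ?_
  · filter_upwards [isOpen_ne.mem_nhds h0] with z hz
    exact gaussKernel_eq_exp hz y
  · rw [gaussKernelDeriv, gaussKernel_eq_exp h0 y, mul_comm]
    congr 1
    have : (Real.pi : ℂ) ≠ 0 := by simp [Real.pi_ne_zero]
    field_simp
    ring

/-- Near a point of the right half-plane, the derivatives in `ζ` of the Gauss kernels are dominated
by one Gauss function times a power. The ball is taken so small that `z` stays away from `0` and
`Re (1 / z)` stays bounded below. -/
theorem gaussKernelDeriv_local_bound (n : ℕ) (hζ : 0 < ζ.re) :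
    ∃ c > 0, ∃ C : ℝ, ∀ z ∈ Metric.ball ζ (ζ.re / 2), 0 < z.re ∧ ∀ y : E n,
      ‖gaussKernelDeriv z y‖ ≤ C * (1 + ‖y‖) ^ 2 * Real.exp (-c * ‖y‖ ^ 2) := by
  set r := ζ.re / 2 with hr
  have hr0 : 0 < r := by positivity
  have hn := norm_pos_iff.2 (ne_zero_of_re_pos hζ)
  refine ⟨r / (16 * ‖ζ‖ ^ 2), by positivity,
    (1 / (4 * r ^ 2) + n / (2 * r)) * (4 * Real.pi * r) ^ (-(n : ℝ) / 2), fun z hz => ?_⟩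
  rw [Metric.mem_ball, dist_eq_norm] at hz
  have h1 : r < z.re := by
    have h' := (Complex.abs_re_le_norm (z - ζ)).trans_lt hz
    rw [Complex.sub_re, abs_lt] at h'
    linarith [h'.1]
  have hz0 : 0 < z.re := hr0.trans h1
  have h2 : r ≤ ‖z‖ := h1.le.trans (Complex.re_le_norm z)
  have h3 : ‖z‖ ≤ 2 * ‖ζ‖ := by
    have : r ≤ ‖ζ‖ := by linarith [Complex.re_le_norm ζ]
    calc ‖z‖ = ‖ζ + (z - ζ)‖ := by congr 1; ring
      _ ≤ ‖ζ‖ + ‖z - ζ‖ := norm_add_le _ _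
      _ ≤ _ := by linarith
  have hz1 : 0 < ‖z‖ := hr0.trans_le h2
  refine ⟨hz0, fun y => ?_⟩
  have hA : ‖((‖y‖ ^ 2 : ℝ) : ℂ) / (4 * z ^ 2) - n / (2 * z)‖ ≤
      (1 / (4 * r ^ 2) + n / (2 * r)) * (1 + ‖y‖) ^ 2 := by
    refine (norm_sub_le _ _).trans ?_
    simp only [norm_div, norm_mul, norm_pow, Complex.norm_real, Complex.norm_natCast, norm_norm,
      Complex.norm_ofNat]
    have e1 : ‖y‖ ^ 2 / (4 * ‖z‖ ^ 2) ≤ (1 + ‖y‖) ^ 2 / (4 * r ^ 2) := by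
      gcongr
      linarith
    have e2 : (n : ℝ) / (2 * ‖z‖) ≤ n / (2 * r) * (1 + ‖y‖) ^ 2 := by
      have e3 : (n : ℝ) / (2 * ‖z‖) ≤ n / (2 * r) := by gcongr
      have e4 : (1 : ℝ) ≤ (1 + ‖y‖) ^ 2 := one_le_pow₀ (by simp)
      exact e3.trans (le_mul_of_one_le_right (by positivity) e4)
    calc _ ≤ (1 + ‖y‖) ^ 2 / (4 * r ^ 2) + n / (2 * r) * (1 + ‖y‖) ^ 2 := add_le_add e1 e2
      _ = _ := by ring
  have hB : ‖gaussKernel z y‖ ≤ (4 * Real.pi * r) ^ (-(n : ℝ) / 2) *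
      Real.exp (-(r / (16 * ‖ζ‖ ^ 2)) * ‖y‖ ^ 2) := by
    rw [norm_gaussKernel hz0]
    have e1 : (4 * Real.pi * ‖z‖) ^ (-(n : ℝ) / 2) ≤ (4 * Real.pi * r) ^ (-(n : ℝ) / 2) := by
      refine Real.rpow_le_rpow_of_nonpos (by positivity) (by gcongr) ?_
      have : (0 : ℝ) ≤ n := Nat.cast_nonneg n
      linarith
    have e2 : r / (16 * ‖ζ‖ ^ 2) ≤ z.re / (4 * ‖z‖ ^ 2) := by
      refine div_le_div₀ hz0.le h1.le (by positivity) ?_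
      calc 4 * ‖z‖ ^ 2 ≤ 4 * (2 * ‖ζ‖) ^ 2 := by gcongr
        _ = _ := by ring
    gcongr
  rw [gaussKernelDeriv, norm_mul]
  calc _ ≤ _ := mul_le_mul hA hB (norm_nonneg _) (by positivity)
    _ = _ := by ring

theorem rapidDecay_gaussKernelDeriv (hζ : 0 < ζ.re) :
    RapidDecay (gaussKernelDeriv ζ : E n → ℂ) := by
  obtain ⟨c, hc, C, h⟩ := gaussKernelDeriv_local_bound n hζ
  exact .of_gauss_bound (continuous_gaussKernelDeriv ζ) hc 2
    (h ζ (Metric.mem_ball_self (by positivity))).2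

/-- The arguments of two points of the right half-plane add up to less than `π`, so the principal
branch of the power is multiplicative there. -/
theorem mul_cpow_of_re_pos {a b : ℂ} (ha : 0 < a.re) (hb : 0 < b.re) (s : ℂ) :
    (a * b) ^ s = a ^ s * b ^ s := by
  have ha0 := ne_zero_of_re_pos ha
  have hb0 := ne_zero_of_re_pos hb
  have h1 := abs_lt.1 (Complex.abs_arg_lt_pi_div_two_iff.2 (.inl ha))
  have h2 := abs_lt.1 (Complex.abs_arg_lt_pi_div_two_iff.2 (.inl hb))
  rw [Complex.cpow_def_of_ne_zero (mul_ne_zero ha0 hb0), Complex.cpow_def_of_ne_zero ha0,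
    Complex.cpow_def_of_ne_zero hb0, Complex.log_mul ha0 hb0 ⟨by linarith, by linarith⟩,
    add_mul, Complex.exp_add]

theorem inv_re_pos (hζ : 0 < ζ.re) : 0 < (ζ⁻¹).re := by
  rw [Complex.inv_re]
  exact div_pos hζ (Complex.normSq_pos.2 (ne_zero_of_re_pos hζ))

theorem ofReal_mul_re_pos {r : ℝ} (hr : 0 < r) (hζ : 0 < ζ.re) : 0 < ((r : ℂ) * ζ).re := by
  rw [Complex.re_ofReal_mul]
  positivity

theorem integral_gaussKernel (hζ : 0 < ζ.re) : ∫ y : E n, gaussKernel ζ y = 1 := by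
  have h0 := ne_zero_of_re_pos hζ
  have hpi : (Real.pi : ℂ) ≠ 0 := by simp [Real.pi_ne_zero]
  have hb : 0 < ((4 * ζ)⁻¹).re := inv_re_pos (by simpa using hζ)
  have h := GaussianFourier.integral_cexp_neg_mul_sq_norm (V := E n) hb
  have h1 : ∀ y : E n, gaussKernel ζ y =
      (4 * Real.pi * ζ) ^ (-(n : ℂ) / 2) * Complex.exp (-(4 * ζ)⁻¹ * ‖y‖ ^ 2) := by
    intro y
    rw [gaussKernel]
    congr 2
    push_cast
    rw [div_eq_mul_inv]
    ring
  simp_rw [h1]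
  rw [integral_const_mul, h]
  have h2 : (Real.pi : ℂ) / (4 * ζ)⁻¹ = 4 * Real.pi * ζ := by rw [div_inv_eq_mul]; ring
  rw [h2, neg_div, Complex.cpow_neg]
  simp only [finrank_euclideanSpace, Fintype.card_fin]
  refine inv_mul_cancel₀ ?_
  simp [Complex.cpow_eq_zero_iff, h0, hpi]

/-- The semigroup law of the Gauss kernels, by completing the square. The powers fit together
because all the arguments lie in the right half-plane, where the principal branch is
multiplicative. -/
theorem integral_gaussKernel_mul {z w : ℂ} (hz : 0 < z.re) (hw : 0 < w.re) (u : E n) :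
    ∫ y, gaussKernel z y * gaussKernel w (u - y) = gaussKernel (z + w) u := by
  have hz0 := ne_zero_of_re_pos hz
  have hw0 := ne_zero_of_re_pos hw
  have hzw : 0 < (z + w).re := by rw [Complex.add_re]; positivity
  have hzw0 := ne_zero_of_re_pos hzw
  have hpi : (Real.pi : ℂ) ≠ 0 := by simp [Real.pi_ne_zero]
  set b : ℂ := (4 * z)⁻¹ + (4 * w)⁻¹ with hbdef
  have hb : 0 < b.re := by
    rw [hbdef, Complex.add_re]
    exact add_pos (inv_re_pos (by simpa using hz)) (inv_re_pos (by simpa using hw))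
  have hb0 := ne_zero_of_re_pos hb
  have hb' : b = (z + w) / (4 * z * w) := by
    rw [hbdef]
    field_simp
    ring
  set s : ℂ := -(n : ℂ) / 2 with hs
  have h1 : ∀ y : E n, gaussKernel z y * gaussKernel w (u - y) =
      ((4 * Real.pi * z) ^ s * (4 * Real.pi * w) ^ s * Complex.exp (-(4 * w)⁻¹ * ‖u‖ ^ 2)) *
        Complex.exp (-b * ‖y‖ ^ 2 + (2 * w)⁻¹ * (inner ℝ u y : ℝ)) := by
    intro y
    have e : ((‖u - y‖ ^ 2 : ℝ) : ℂ) = ‖u‖ ^ 2 - 2 * (inner ℝ u y : ℝ) + ‖y‖ ^ 2 := by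
      rw [norm_sub_sq_real]
      push_cast
      ring
    rw [gaussKernel, gaussKernel, e]
    have : ∀ A B C D F G : ℂ, C + D = F + G → A * Complex.exp C * (B * Complex.exp D) =
        A * B * Complex.exp F * Complex.exp G := by
      intro A B C D F G h
      calc _ = A * B * (Complex.exp C * Complex.exp D) := by ring
        _ = A * B * (Complex.exp F * Complex.exp G) := by
          rw [← Complex.exp_add, ← Complex.exp_add, h]
        _ = _ := by ring
    apply this
    rw [hbdef]
    push_cast
    field_simp
    ring
  simp_rw [h1]
  rw [integral_const_mul, GaussianFourier.integral_cexp_neg_mul_sq_norm_add hb]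
  simp only [finrank_euclideanSpace, Fintype.card_fin]
  have p4 : (0 : ℝ) < 4 * Real.pi := by positivity
  have e4 : ∀ x : ℂ, 4 * (Real.pi : ℂ) * x = ((4 * Real.pi : ℝ) : ℂ) * x := by
    intro x; push_cast; ring
  have r1 : 0 < (4 * Real.pi * z : ℂ).re := e4 z ▸ ofReal_mul_re_pos p4 hz
  have r2 : 0 < (4 * Real.pi * w : ℂ).re := e4 w ▸ ofReal_mul_re_pos p4 hw
  have r3 : 0 < (4 * Real.pi * (z + w) : ℂ).re := e4 (z + w) ▸ ofReal_mul_re_pos p4 hzw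
  have r4 : 0 < (Real.pi / b : ℂ).re := by
    rw [div_eq_mul_inv]
    exact ofReal_mul_re_pos Real.pi_pos (inv_re_pos hb)
  have hpow : (4 * Real.pi * z : ℂ) ^ s * (4 * Real.pi * w) ^ s * (Real.pi / b) ^ (n / 2 : ℂ) =
      (4 * Real.pi * (z + w)) ^ s := by
    have hprod : (4 * Real.pi * z : ℂ) * (4 * Real.pi * w) =
        (4 * Real.pi * (z + w)) * (Real.pi / b) := by
      rw [hb']
      field_simp
    rw [← mul_cpow_of_re_pos r1 r2, hprod, mul_cpow_of_re_pos r3 r4, mul_assoc]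
    have : (n / 2 : ℂ) = -s := by rw [hs]; ring
    rw [this, Complex.cpow_neg, mul_inv_cancel₀, mul_one]
    simp [Complex.cpow_eq_zero_iff, hb0, hpi]
  rw [gaussKernel, ← hs, ← hpow]
  have : ∀ A B C D F G : ℂ, C + D = G → A * Complex.exp C * (B * Complex.exp D) =
      A * B * Complex.exp G := by
    intro A B C D F G h
    rw [← h, Complex.exp_add]
    ring
  apply this _ _ _ _ 0
  rw [hb']
  push_cast
  field_simp
  ring

theorem re_pos_of_mem_sector {θ : ℝ} (hθ : θ ≤ Real.pi / 2) {z : ℂ} (hz : z ∈ sector θ) :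
    0 < z.re := by
  rcases Complex.abs_arg_lt_pi_div_two_iff.1 (hz.2.trans_le hθ) with h | h
  · exact h
  · exact absurd h hz.1

theorem ofReal_mem_sector {t : ℝ} (ht : 0 < t) {α : ℝ} (h0 : 0 < α) : (t : ℂ) ∈ sector α :=
  ⟨by exact_mod_cast ht.ne', by rwa [Complex.arg_ofReal_of_nonneg ht.le, abs_zero]⟩

/-- The Gauss function on `ℝⁿ` that, after rescaling by `√‖ζ‖`, dominates all the kernels `χ_ζ`
with `ζ` in the sector of angle `α`. -/
def sectorMajorant (n : ℕ) (α : ℝ) (z : E n) : ℝ :=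
  (4 * Real.pi) ^ (-(n : ℝ) / 2) * Real.exp (-(Real.cos α / 4) * ‖z‖ ^ 2)

theorem sectorMajorant_nonneg (α : ℝ) (z : E n) : 0 ≤ sectorMajorant n α z := by
  unfold sectorMajorant
  positivity

theorem rapidDecay_sectorMajorant {α : ℝ} (h0 : 0 < α) (h : α < Real.pi / 2) :
    RapidDecay (sectorMajorant n α) := by
  have hc : 0 < Real.cos α := Real.cos_pos_of_mem_Ioo ⟨by linarith [Real.pi_pos], h⟩
  refine .of_gauss_bound (C := (4 * Real.pi) ^ (-(n : ℝ) / 2)) (by unfold sectorMajorant; fun_prop)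
    (by positivity : 0 < Real.cos α / 4) 0 fun y => ?_
  rw [pow_zero, mul_one, Real.norm_of_nonneg (sectorMajorant_nonneg α y), sectorMajorant]

theorem norm_gaussKernel_le_sectorMajorant {α : ℝ} (h0 : 0 < α) (h : α < Real.pi / 2)
    (hζ : ζ ∈ sector α) (y : E n) : ‖gaussKernel ζ y‖ ≤
      (√‖ζ‖ ^ n)⁻¹ * sectorMajorant n α ((√‖ζ‖)⁻¹ • y) := by
  have hre := re_pos_of_mem_sector h.le hζ
  have hn := norm_pos_iff.2 hζ.1
  rw [norm_gaussKernel hre, sectorMajorant, norm_smul, norm_inv,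
    Real.norm_of_nonneg (Real.sqrt_nonneg _), mul_pow, inv_pow, Real.sq_sqrt hn.le,
    Real.mul_rpow (by positivity) hn.le]
  have e1 : ‖ζ‖ ^ (-(n : ℝ) / 2) = (√‖ζ‖ ^ n)⁻¹ := by
    rw [Real.sqrt_eq_rpow, ← Real.rpow_mul_natCast hn.le, ← Real.rpow_neg hn.le]
    congr 1
    ring
  have e2 : Real.cos α * ‖ζ‖ ≤ ζ.re := by
    have : Real.cos α ≤ Real.cos (Complex.arg ζ) := by
      rw [← Real.cos_abs (Complex.arg ζ)]
      exact Real.cos_le_cos_of_nonneg_of_le_pi (abs_nonneg _) (by linarith [Real.pi_pos]) hζ.2.le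
    rw [Complex.cos_arg hζ.1, le_div_iff₀ hn] at this
    exact this
  rw [e1, mul_comm ((4 * Real.pi) ^ _), mul_assoc]
  have e3 : Real.cos α / 4 * ‖ζ‖⁻¹ ≤ ζ.re / (4 * ‖ζ‖ ^ 2) := by
    rw [le_div_iff₀ (by positivity)]
    calc _ = Real.cos α * ‖ζ‖ := by field_simp
      _ ≤ _ := e2
  refine mul_le_mul_of_nonneg_left (mul_le_mul_of_nonneg_left (Real.exp_le_exp.2 ?_)
    (by positivity)) (by positivity)
  calc -(ζ.re / (4 * ‖ζ‖ ^ 2)) * ‖y‖ ^ 2 ≤ -(Real.cos α / 4 * ‖ζ‖⁻¹) * ‖y‖ ^ 2 := by gcongr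
    _ = _ := by ring

/-- Substitution `y = √‖ζ‖ z` in an integral against a Gauss kernel. -/
theorem integral_norm_gaussKernel_mul_le {α : ℝ} (h0 : 0 < α) (h : α < Real.pi / 2)
    (hζ : ζ ∈ sector α) {F : E n → ℝ} (hF : ∀ y, 0 ≤ F y)
    (hint : Integrable fun z => sectorMajorant n α z * F (√‖ζ‖ • z)) :
    ∫ y, ‖gaussKernel ζ y‖ * F y ≤ ∫ z, sectorMajorant n α z * F (√‖ζ‖ • z) := by
  set r := √‖ζ‖ with hr
  have hr0 : 0 < r := Real.sqrt_pos.2 (norm_pos_iff.2 hζ.1)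
  set H : E n → ℝ := fun z => sectorMajorant n α z * F (r • z) with hH
  have e1 : ∀ y : E n, (r ^ n)⁻¹ * sectorMajorant n α (r⁻¹ • y) * F y = (r ^ n)⁻¹ * H (r⁻¹ • y) := by
    intro y
    simp only [hH, smul_smul, mul_inv_cancel₀ hr0.ne', one_smul, mul_assoc]
  have e2 : ∫ y, (r ^ n)⁻¹ * H (r⁻¹ • y) = ∫ z, H z := by
    rw [integral_const_mul, Measure.integral_comp_inv_smul_of_nonneg _ _ hr0.le]
    simp only [finrank_euclideanSpace, Fintype.card_fin, smul_eq_mul]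
    rw [← mul_assoc, inv_mul_cancel₀ (by positivity), one_mul]
  rw [← e2]
  refine integral_mono_of_nonneg (.of_forall fun y => mul_nonneg (norm_nonneg _) (hF y)) ?_
    (.of_forall fun y => ?_)
  · exact (hint.comp_smul (inv_ne_zero hr0.ne')).const_mul _
  · simp only [← e1]
    exact mul_le_mul_of_nonneg_right (norm_gaussKernel_le_sectorMajorant h0 h hζ y) (hF y)

end Kernel

/-! ### Convolution operators of a weighted translation group -/

section TranslationGroup

variable {n : ℕ} {k : ℝ} {Z : Type*} [NormedAddCommGroup Z] [NormedSpace ℂ Z]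

/-- `U` is a strongly continuous representation of the group `ℝⁿ` on `Z` that grows at most as
fast as the weight. The translations `(U y f)(x) = f (x - y)` on `w X` are of this kind. -/
structure IsWeightedTranslation (k : ℝ) (U : E n → Z →L[ℂ] Z) : Prop where
  map_zero : U 0 = ContinuousLinearMap.id ℂ Z
  map_add : ∀ x y, U (x + y) = (U x).comp (U y)
  norm_le : ∀ y, ‖U y‖ ≤ weight k y
  tendsto_zero : ∀ f, Tendsto (fun y => U y f) (𝓝 0) (𝓝 f)

/-- `a` belongs to the weighted space `L¹(ℝⁿ, w dy)`. -/
structure WeightedIntegrable (k : ℝ) (a : E n → ℂ) : Prop where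
  meas : AEStronglyMeasurable a volume
  int : Integrable fun y => weight k y * ‖a y‖

theorem RapidDecay.weightedIntegrable {a : E n → ℂ} (ha : RapidDecay a) (k : ℝ) :
    WeightedIntegrable k a :=
  ⟨ha.continuous.aestronglyMeasurable, ha.integrable_weight k⟩

variable {U : E n → Z →L[ℂ] Z}

namespace IsWeightedTranslation

theorem norm_apply_le (hU : IsWeightedTranslation k U) (y : E n) (f : Z) :
    ‖U y f‖ ≤ weight k y * ‖f‖ :=
  ((U y).le_opNorm f).trans (by gcongr; exact hU.norm_le y)

theorem continuous (hU : IsWeightedTranslation k U) (f : Z) : Continuous fun y => U y f := by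
  refine continuous_iff_continuousAt.2 fun y => ?_
  have h1 : Tendsto (fun z : E n => z - y) (𝓝 y) (𝓝 0) := by
    have : Continuous fun z : E n => z - y := by fun_prop
    simpa using this.tendsto y
  have h2 := ((U y).continuous.tendsto f).comp ((hU.tendsto_zero f).comp h1)
  refine h2.congr fun z => ?_
  have : U z = (U y).comp (U (z - y)) := by rw [← hU.map_add]; congr 1; abel
  rw [this]
  rfl

theorem integrable_smul (hU : IsWeightedTranslation k U) {a : E n → ℂ}
    (ha : WeightedIntegrable k a) (f : Z) : Integrable fun y => a y • U y f := by
  refine (ha.int.mul_const ‖f‖).mono' (ha.meas.smul (hU.continuous f).aestronglyMeasurable)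
    (.of_forall fun y => ?_)
  rw [norm_smul]
  calc ‖a y‖ * ‖U y f‖ ≤ ‖a y‖ * (weight k y * ‖f‖) := by
        gcongr
        exact hU.norm_apply_le y f
    _ = _ := by ring

theorem norm_integral_smul_le (hU : IsWeightedTranslation k U) {a : E n → ℂ}
    (ha : WeightedIntegrable k a) (f : Z) :
    ‖∫ y, a y • U y f‖ ≤ (∫ y, weight k y * ‖a y‖) * ‖f‖ := by
  rw [← integral_mul_const]
  refine norm_integral_le_of_norm_le (ha.int.mul_const ‖f‖) (.of_forall fun y => ?_)
  rw [norm_smul]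
  calc ‖a y‖ * ‖U y f‖ ≤ ‖a y‖ * (weight k y * ‖f‖) := by
        gcongr
        exact hU.norm_apply_le y f
    _ = _ := by ring

/-- The convolution operator `f ↦ ∫ a(y) U(y) f dy`, a Bochner integral in `Z`. -/
def convOp (hU : IsWeightedTranslation k U) (a : E n → ℂ) (ha : WeightedIntegrable k a) :
    Z →L[ℂ] Z :=
  LinearMap.mkContinuous
    { toFun := fun f => ∫ y, a y • U y f
      map_add' := fun f g => by
        rw [← integral_add (hU.integrable_smul ha f) (hU.integrable_smul ha g)]
        simp
      map_smul' := fun c f => by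
        rw [RingHom.id_apply, ← integral_smul]
        refine integral_congr_ae (.of_forall fun y => ?_)
        simp only [map_smul]
        exact smul_comm _ _ _ }
    (∫ y, weight k y * ‖a y‖) (hU.norm_integral_smul_le ha)

theorem convOp_apply (hU : IsWeightedTranslation k U) {a : E n → ℂ} (ha : WeightedIntegrable k a)
    (f : Z) : hU.convOp a ha f = ∫ y, a y • U y f := rfl

theorem norm_convOp_le (hU : IsWeightedTranslation k U) {a : E n → ℂ}
    (ha : WeightedIntegrable k a) : ‖hU.convOp a ha‖ ≤ ∫ y, weight k y * ‖a y‖ :=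
  LinearMap.mkContinuous_norm_le _
    (integral_nonneg fun y => mul_nonneg (weight_pos k y).le (norm_nonneg _)) _

variable [CompleteSpace Z]

/-- The composition of convolution operators is the operator of the convolution of the kernels. -/
theorem convOp_comp (hU : IsWeightedTranslation k U) {a b c : E n → ℂ}
    (ha : WeightedIntegrable k a) (hb : WeightedIntegrable k b) (hc : WeightedIntegrable k c)
    (h : ∀ u, ∫ y, a y * b (u - y) = c u) :
    (hU.convOp a ha).comp (hU.convOp b hb) = hU.convOp c hc := by
  ext f
  rw [ContinuousLinearMap.comp_apply, hU.convOp_apply, hU.convOp_apply]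
  have e1 : ∀ y, a y • U y (∫ z, b z • U z f) = ∫ u, (a y * b (u - y)) • U u f := by
    intro y
    rw [← (U y).integral_comp_comm (hU.integrable_smul hb f), ← integral_smul,
      ← integral_sub_right_eq_self _ y]
    refine integral_congr_ae (.of_forall fun u => ?_)
    have : U u = (U y).comp (U (u - y)) := by rw [← hU.map_add]; congr 1; abel
    simp only [map_smul, smul_smul]
    rw [this]
    rfl
  simp_rw [e1]
  have hprod : Integrable (fun p : E n × E n => (a p.2 * b (p.1 - p.2)) • U p.1 f)
      (volume.prod volume) := by
    have hdom := ha.int.convolution_integrand (ContinuousLinearMap.mul ℝ ℝ) hb.int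
    have hm1 : AEStronglyMeasurable (fun p : E n × E n => a p.2 * b (p.1 - p.2))
        (volume.prod volume) :=
      ha.meas.convolution_integrand (ContinuousLinearMap.mul ℝ ℂ) hb.meas
    refine (hdom.mul_const ‖f‖).mono' (hm1.smul
      ((hU.continuous f).comp continuous_fst).aestronglyMeasurable) (.of_forall fun p => ?_)
    rw [norm_smul, norm_mul, ContinuousLinearMap.mul_apply']
    have hw : ‖U p.1 f‖ ≤ weight k p.2 * weight k (p.1 - p.2) * ‖f‖ := by
      have : U p.1 = (U p.2).comp (U (p.1 - p.2)) := by rw [← hU.map_add]; congr 1; abel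
      rw [this]
      refine (hU.norm_apply_le _ _).trans ?_
      rw [mul_assoc]
      exact mul_le_mul_of_nonneg_left (hU.norm_apply_le _ _) (weight_pos k _).le
    calc _ ≤ ‖a p.2‖ * ‖b (p.1 - p.2)‖ * (weight k p.2 * weight k (p.1 - p.2) * ‖f‖) := by gcongr
      _ = _ := by ring
  rw [← integral_integral_swap (f := fun u y => (a y * b (u - y)) • U u f) hprod]
  refine integral_congr_ae (.of_forall fun u => ?_)
  simp only
  rw [integral_smul_const, h]

end IsWeightedTranslation

end TranslationGroup

/-! ### The Gauss semigroup of a weighted translation group -/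

section GaussSemigroup

variable {n : ℕ} {k : ℝ} {Z : Type*} [NormedAddCommGroup Z] [NormedSpace ℂ Z]
  {U : E n → Z →L[ℂ] Z}

namespace IsWeightedTranslation

open Classical in
/-- `G(ζ) f = ∫ χ_ζ(y) U(y) f dy` in the right half-plane; the identity elsewhere, in particular
at the origin. -/
def gaussOp (hU : IsWeightedTranslation k U) (ζ : ℂ) : Z →L[ℂ] Z :=
  if h : 0 < ζ.re then
    hU.convOp (gaussKernel ζ) ((rapidDecay_gaussKernel h).weightedIntegrable k)
  else ContinuousLinearMap.id ℂ Z

theorem gaussOp_of_pos (hU : IsWeightedTranslation k U) {ζ : ℂ} (h : 0 < ζ.re) :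
    hU.gaussOp ζ = hU.convOp (gaussKernel ζ) ((rapidDecay_gaussKernel h).weightedIntegrable k) :=
  dif_pos h

theorem gaussOp_zero (hU : IsWeightedTranslation k U) :
    hU.gaussOp 0 = ContinuousLinearMap.id ℂ Z := dif_neg (by simp)

theorem gaussOp_apply (hU : IsWeightedTranslation k U) {ζ : ℂ} (h : 0 < ζ.re) (f : Z) :
    hU.gaussOp ζ f = ∫ y, gaussKernel ζ y • U y f := by
  rw [hU.gaussOp_of_pos h, hU.convOp_apply]

theorem gaussOp_add [CompleteSpace Z] (hU : IsWeightedTranslation k U) {z w : ℂ} (hz : 0 < z.re)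
    (hw : 0 < w.re) : hU.gaussOp (z + w) = (hU.gaussOp z).comp (hU.gaussOp w) := by
  have hzw : 0 < (z + w).re := by rw [Complex.add_re]; positivity
  rw [hU.gaussOp_of_pos hz, hU.gaussOp_of_pos hw, hU.gaussOp_of_pos hzw]
  exact (hU.convOp_comp _ _ _ (integral_gaussKernel_mul hz hw)).symm

/-- `ζ ↦ G(ζ)` is holomorphic in operator norm because `ζ ↦ χ_ζ` is differentiable in the weighted
`L¹` space, by dominated convergence of the difference quotients. -/
theorem hasDerivAt_gaussOp (hU : IsWeightedTranslation k U) {ζ : ℂ} (hζ : 0 < ζ.re) :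
    HasDerivAt hU.gaussOp (hU.convOp (gaussKernelDeriv ζ)
      ((rapidDecay_gaussKernelDeriv hζ).weightedIntegrable k)) ζ := by
  rw [hasDerivAt_iff_tendsto]
  obtain ⟨c, hc, C, hC⟩ := gaussKernelDeriv_local_bound n hζ
  have hball : Metric.ball ζ (ζ.re / 2) ∈ 𝓝 ζ := Metric.ball_mem_nhds _ (by positivity)
  -- The dominating function of the remainder of first order.
  set D : E n → ℝ := fun y => C * (1 + ‖y‖) ^ 2 * Real.exp (-c * ‖y‖ ^ 2) with hDdef
  have hD0 : ∀ y, 0 ≤ D y := fun y =>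
    (norm_nonneg _).trans ((hC ζ (mem_of_mem_nhds hball)).2 y)
  have hDr : RapidDecay D := .of_gauss_bound (by simp only [hDdef]; fun_prop) hc 2 fun y => by
    rw [Real.norm_of_nonneg (hD0 y)]
  set R : ℂ → E n → ℂ := fun z y =>
    gaussKernel z y - gaussKernel ζ y - (z - ζ) * gaussKernelDeriv ζ y with hR
  have hRc : ∀ z, Continuous (R z) := fun z =>
    ((continuous_gaussKernel z).sub (continuous_gaussKernel ζ)).sub
      (continuous_const.mul (continuous_gaussKernelDeriv ζ))
  have hRb : ∀ z ∈ Metric.ball ζ (ζ.re / 2), ∀ y, ‖R z y‖ ≤ ‖z - ζ‖ * (2 * D y) := by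
    intro z hz y
    have h1 : ‖gaussKernel z y - gaussKernel ζ y‖ ≤ D y * ‖z - ζ‖ :=
      (convex_ball ζ (ζ.re / 2)).norm_image_sub_le_of_norm_hasDerivWithin_le
        (f := fun z => gaussKernel z y) (f' := fun z => gaussKernelDeriv z y)
        (fun x hx => (hasDerivAt_gaussKernel (hC x hx).1 y).hasDerivWithinAt)
        (fun x hx => (hC x hx).2 y) (mem_of_mem_nhds hball) hz
    have h2 := (hC ζ (mem_of_mem_nhds hball)).2 y
    refine (norm_sub_le _ _).trans ?_
    rw [norm_mul]
    calc _ ≤ D y * ‖z - ζ‖ + ‖z - ζ‖ * D y := by gcongr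
      _ = _ := by ring
  have hint : Integrable fun y => weight k y * (2 * D y) := by
    refine ((hDr.integrable_weight k).const_mul 2).congr (.of_forall fun y => ?_)
    simp only [Real.norm_of_nonneg (hD0 y)]
    ring
  -- The operator norm of the remainder is bounded by this weighted `L¹` norm.
  have hlim : Tendsto (fun z => ∫ y, weight k y * (‖z - ζ‖⁻¹ * ‖R z y‖)) (𝓝 ζ)
      (𝓝 (∫ _ : E n, (0 : ℝ))) := by
    refine tendsto_integral_filter_of_dominated_convergence (fun y => weight k y * (2 * D y))
      (.of_forall fun z => ((continuous_weight k).mul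
        (continuous_const.mul (hRc z).norm)).aestronglyMeasurable) ?_ hint
      (.of_forall fun y => ?_)
    · filter_upwards [hball] with z hz
      refine .of_forall fun y => ?_
      rw [Real.norm_of_nonneg (mul_nonneg (weight_pos k y).le (by positivity))]
      refine mul_le_mul_of_nonneg_left ?_ (weight_pos k y).le
      rcases eq_or_ne z ζ with rfl | hne
      · simpa using hD0 y
      · have : 0 < ‖z - ζ‖ := norm_pos_iff.2 (sub_ne_zero.2 hne)
        rw [inv_mul_le_iff₀ this]
        exact hRb z hz y
    · have := hasDerivAt_iff_tendsto.1 (hasDerivAt_gaussKernel hζ y)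
      simpa [hR] using this.const_mul (weight k y)
  rw [integral_zero] at hlim
  refine squeeze_zero' (.of_forall fun z => by positivity) ?_ hlim
  filter_upwards [hball] with z hz
  have hz0 := (hC z hz).1
  have hRw : WeightedIntegrable k (R z) := by
    refine ⟨(hRc z).aestronglyMeasurable, (hint.const_mul ‖z - ζ‖).mono'
      ((continuous_weight k).mul (hRc z).norm).aestronglyMeasurable (.of_forall fun y => ?_)⟩
    rw [Real.norm_of_nonneg (mul_nonneg (weight_pos k y).le (norm_nonneg _))]
    calc _ ≤ weight k y * (‖z - ζ‖ * (2 * D y)) :=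
          mul_le_mul_of_nonneg_left (hRb z hz y) (weight_pos k y).le
      _ = _ := by ring
  have heq : hU.gaussOp z - hU.gaussOp ζ - (z - ζ) • hU.convOp (gaussKernelDeriv ζ)
      ((rapidDecay_gaussKernelDeriv hζ).weightedIntegrable k) = hU.convOp (R z) hRw := by
    ext f
    have i1 := hU.integrable_smul ((rapidDecay_gaussKernel hz0).weightedIntegrable k) f
    have i2 := hU.integrable_smul ((rapidDecay_gaussKernel hζ).weightedIntegrable k) f
    have i3 : Integrable fun y => (z - ζ) • gaussKernelDeriv ζ y • U y f :=
      (hU.integrable_smul ((rapidDecay_gaussKernelDeriv hζ).weightedIntegrable k) f).smul (z - ζ)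
    have i4 : Integrable fun y => gaussKernel z y • U y f - gaussKernel ζ y • U y f := i1.sub i2
    simp only [sub_apply, smul_apply, hU.gaussOp_of_pos hz0,
      hU.gaussOp_of_pos hζ, hU.convOp_apply]
    rw [← integral_smul, ← integral_sub i1 i2, ← integral_sub i4 i3]
    refine integral_congr_ae (.of_forall fun y => ?_)
    simp only [hR, sub_smul, mul_smul]
  rw [heq]
  calc _ ≤ ‖z - ζ‖⁻¹ * ∫ y, weight k y * ‖R z y‖ := by
        gcongr
        exact hU.norm_convOp_le hRw
    _ = _ := by
        rw [← integral_const_mul]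
        refine integral_congr_ae (.of_forall fun y => ?_)
        simp only
        ring

theorem norm_gaussOp_le (hU : IsWeightedTranslation k U) (hk : 0 ≤ k) {α : ℝ} (h0 : 0 < α)
    (h : α < Real.pi / 2) {z : ℂ} (hz : z ∈ sector α) (hz1 : ‖z‖ ≤ 1) :
    ‖hU.gaussOp z‖ ≤ ∫ y : E n, sectorMajorant n α y * weight k y := by
  have hre := re_pos_of_mem_sector h.le hz
  have hr1 : √‖z‖ ≤ 1 := Real.sqrt_le_one.2 hz1
  have hint : Integrable fun y : E n => sectorMajorant n α y * weight k y := by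
    refine ((rapidDecay_sectorMajorant h0 h).integrable_weight k).congr (.of_forall fun y => ?_)
    simp only [Real.norm_of_nonneg (sectorMajorant_nonneg α y)]
    ring
  have hle : ∀ y : E n, sectorMajorant n α y * weight k (√‖z‖ • y) ≤
      sectorMajorant n α y * weight k y := fun y =>
    mul_le_mul_of_nonneg_left (weight_smul_le hk (Real.sqrt_nonneg _) hr1 y)
      (sectorMajorant_nonneg α y)
  have hint' : Integrable fun y : E n => sectorMajorant n α y * weight k (√‖z‖ • y) := by
    refine hint.mono' ((rapidDecay_sectorMajorant h0 h).continuous.mul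
      ((continuous_weight k).comp (continuous_const_smul _))).aestronglyMeasurable
      (.of_forall fun y => ?_)
    rw [Real.norm_of_nonneg (mul_nonneg (sectorMajorant_nonneg α y) (weight_pos k _).le)]
    exact hle y
  rw [hU.gaussOp_of_pos hre]
  refine (hU.norm_convOp_le _).trans ?_
  calc _ = ∫ y : E n, ‖gaussKernel z y‖ * weight k y := by simp_rw [mul_comm]
    _ ≤ _ := integral_norm_gaussKernel_mul_le h0 h hz (fun y => (weight_pos k y).le) hint'
    _ ≤ _ := integral_mono hint' hint hle

/-- After the substitution `y = √‖z‖ u`, the error `G(z) f - f` is dominated by a fixed Gauss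
integral of `‖U (√‖z‖ u) f - f‖`, which tends to `0` by strong continuity. -/
theorem tendsto_gaussOp_zero [CompleteSpace Z] (hU : IsWeightedTranslation k U) (hk : 0 ≤ k)
    {α : ℝ} (h0 : 0 < α) (h : α < Real.pi / 2) (f : Z) :
    Tendsto (fun z => hU.gaussOp z f) (𝓝[sector α] 0) (𝓝 f) := by
  rw [tendsto_iff_norm_sub_tendsto_zero]
  have hmaj := rapidDecay_sectorMajorant (n := n) h0 h
  have hF : Continuous fun y => ‖U y f - f‖ := ((hU.continuous f).sub continuous_const).norm
  have hcont : ∀ z : ℂ, Continuous fun y => sectorMajorant n α y * ‖U (√‖z‖ • y) f - f‖ :=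
    fun z => hmaj.continuous.mul (hF.comp (continuous_const_smul (√‖z‖)))
  have hbd : ∀ y, ‖U y f - f‖ ≤ 2 * weight k y * ‖f‖ := by
    intro y
    refine (norm_sub_le _ _).trans ?_
    have h1 := hU.norm_apply_le y f
    have h2 : ‖f‖ ≤ weight k y * ‖f‖ :=
      le_mul_of_one_le_left (norm_nonneg _) (one_le_weight hk y)
    linarith
  have hint : Integrable fun y : E n => sectorMajorant n α y * (2 * weight k y * ‖f‖) := by
    refine ((hmaj.integrable_weight k).const_mul (2 * ‖f‖)).congr (.of_forall fun y => ?_)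
    simp only [Real.norm_of_nonneg (sectorMajorant_nonneg α y)]
    ring
  have hdom : ∀ z : ℂ, ‖z‖ ≤ 1 → ∀ y, ‖sectorMajorant n α y * ‖U (√‖z‖ • y) f - f‖‖ ≤
      sectorMajorant n α y * (2 * weight k y * ‖f‖) := by
    intro z hz y
    rw [Real.norm_of_nonneg (mul_nonneg (sectorMajorant_nonneg α y) (norm_nonneg _))]
    refine mul_le_mul_of_nonneg_left ((hbd _).trans ?_) (sectorMajorant_nonneg α y)
    gcongr
    exact weight_smul_le hk (Real.sqrt_nonneg _) (Real.sqrt_le_one.2 hz) y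
  have hsmall : ∀ᶠ z in 𝓝[sector α] (0 : ℂ), z ∈ sector α ∧ ‖z‖ ≤ 1 := by
    refine eventually_mem_nhdsWithin.and (nhdsWithin_le_nhds ?_)
    filter_upwards [Metric.closedBall_mem_nhds (0 : ℂ) one_pos] with z hz
    simpa using hz
  have hlim : Tendsto (fun z : ℂ => ∫ y, sectorMajorant n α y * ‖U (√‖z‖ • y) f - f‖)
      (𝓝[sector α] 0) (𝓝 (∫ _ : E n, (0 : ℝ))) := by
    refine tendsto_integral_filter_of_dominated_convergence
      (fun y => sectorMajorant n α y * (2 * weight k y * ‖f‖))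
      (.of_forall fun z => (hcont z).aestronglyMeasurable)
      (hsmall.mono fun z hz => .of_forall (hdom z hz.2)) hint (.of_forall fun y => ?_)
    have h1 : Continuous fun z : ℂ => sectorMajorant n α y * ‖U (√‖z‖ • y) f - f‖ := by
      have : Continuous fun z : ℂ => √‖z‖ • y := by fun_prop
      exact continuous_const.mul (hF.comp this)
    have h2 := h1.tendsto 0
    simp only [norm_zero, Real.sqrt_zero, zero_smul, hU.map_zero, ContinuousLinearMap.id_apply,
      sub_self, mul_zero] at h2
    exact h2.mono_left nhdsWithin_le_nhds
  rw [integral_zero] at hlim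
  refine squeeze_zero' (.of_forall fun z => norm_nonneg _) ?_ hlim
  filter_upwards [hsmall] with z ⟨hz, hz1⟩
  have hre := re_pos_of_mem_sector h.le hz
  have hsub : hU.gaussOp z f - f = ∫ y, gaussKernel z y • (U y f - f) := by
    have hk1 := (rapidDecay_gaussKernel (n := n) hre).integrable
    have : ∫ y : E n, gaussKernel z y • f = f := by
      rw [integral_smul_const, integral_gaussKernel hre, one_smul]
    simp_rw [smul_sub]
    rw [integral_sub (hU.integrable_smul ((rapidDecay_gaussKernel hre).weightedIntegrable k) f)
      (hk1.smul_const f), this, hU.gaussOp_apply hre]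
  rw [hsub]
  refine (norm_integral_le_integral_norm _).trans ?_
  simp_rw [norm_smul]
  exact integral_norm_gaussKernel_mul_le h0 h hz (fun y => norm_nonneg _)
    (hint.mono' (hcont z).aestronglyMeasurable (.of_forall (hdom z hz1)))

theorem continuousOn_gaussOp_ofReal [CompleteSpace Z] (hU : IsWeightedTranslation k U)
    (hk : 0 ≤ k) (f : Z) : ContinuousOn (fun t : ℝ => hU.gaussOp (t : ℂ) f) (Ici 0) := by
  intro t ht
  rcases (mem_Ici.1 ht).eq_or_lt with rfl | ht
  · rw [← continuousWithinAt_Ioi_iff_Ici]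
    have hα : (0 : ℝ) < Real.pi / 4 := by positivity
    have h1 : Tendsto (fun t : ℝ => (t : ℂ)) (𝓝[>] 0) (𝓝[sector (Real.pi / 4)] 0) := by
      refine tendsto_nhdsWithin_iff.2 ⟨?_, ?_⟩
      · simpa using (Complex.continuous_ofReal.tendsto 0).mono_left nhdsWithin_le_nhds
      · filter_upwards [self_mem_nhdsWithin] with t ht
        exact ofReal_mem_sector ht hα
    have h2 := (hU.tendsto_gaussOp_zero hk hα (by linarith [Real.pi_pos]) f).comp h1
    simpa [ContinuousWithinAt, hU.gaussOp_zero, Function.comp_def] using h2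
  · have h1 : ContinuousAt hU.gaussOp (t : ℂ) :=
      (hU.hasDerivAt_gaussOp (by simpa using ht)).continuousAt
    have h2 : ContinuousAt (fun t : ℝ => hU.gaussOp (t : ℂ)) t :=
      h1.comp (f := fun t : ℝ => (t : ℂ)) Complex.continuous_ofReal.continuousAt
    exact (h2.clm_apply continuousAt_const).continuousWithinAt

theorem isHolomorphicC0Semigroup [CompleteSpace Z] (hU : IsWeightedTranslation k U)
    (hk : 0 ≤ k) : IsHolomorphicC0Semigroup (Real.pi / 2) hU.gaussOp where
  isC0Semigroup :=
    { map_zero := by simpa using hU.gaussOp_zero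
      map_add := by
        intro s t hs ht
        rcases hs.eq_or_lt with rfl | hs
        · ext f
          simp [hU.gaussOp_zero]
        rcases ht.eq_or_lt with rfl | ht
        · ext f
          simp [hU.gaussOp_zero]
        rw [Complex.ofReal_add]
        exact hU.gaussOp_add (by simpa using hs) (by simpa using ht)
      strongly_continuous := hU.continuousOn_gaussOp_ofReal hk }
  holomorphic z hz :=
    (hU.hasDerivAt_gaussOp (re_pos_of_mem_sector le_rfl hz)).differentiableAt.differentiableWithinAt
  map_add z hz w hw :=
    hU.gaussOp_add (re_pos_of_mem_sector le_rfl hz) (re_pos_of_mem_sector le_rfl hw)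
  bounded α h0 h := ⟨_, fun _ hz hz1 => hU.norm_gaussOp_le hk h0 h hz hz1⟩
  tendsto_zero α h0 h f := hU.tendsto_gaussOp_zero hk h0 h f

end IsWeightedTranslation

end GaussSemigroup

/-! ### Functions of polynomial growth and their pairings with test functions -/

section Pairing

open scoped LineDeriv

variable {n : ℕ} {Y : Type*} [NormedAddCommGroup Y] [NormedSpace ℂ Y]

theorem RapidDecay.sub {a b : E n → ℂ} (ha : RapidDecay a) (hb : RapidDecay b) :
    RapidDecay fun y => a y - b y := by
  refine ⟨ha.continuous.sub hb.continuous, fun N => ?_⟩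
  obtain ⟨C, hC⟩ := ha.bound N
  obtain ⟨D, hD⟩ := hb.bound N
  refine ⟨C + D, fun y => ?_⟩
  calc _ ≤ (1 + ‖y‖) ^ N * (‖a y‖ + ‖b y‖) := by gcongr; exact norm_sub_le _ _
    _ ≤ C + D := by rw [mul_add]; exact add_le_add (hC y) (hD y)

theorem RapidDecay.const_mul {a : E n → ℂ} (ha : RapidDecay a) (c : ℂ) :
    RapidDecay fun y => c * a y := by
  refine ⟨continuous_const.mul ha.continuous, fun N => ?_⟩
  obtain ⟨C, hC⟩ := ha.bound N
  refine ⟨‖c‖ * C, fun y => ?_⟩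
  calc _ = ‖c‖ * ((1 + ‖y‖) ^ N * ‖a y‖) := by rw [norm_mul]; ring
    _ ≤ _ := by gcongr; exact hC y

theorem rapidDecay_schwartz (ψ : 𝓢(E n, ℂ)) : RapidDecay ψ := by
  refine ⟨ψ.continuous, fun N =>
    ⟨2 ^ N * ((Finset.Iic (N, 0)).sup (schwartzSeminormFamily ℂ (E n) ℂ)) ψ, fun y => ?_⟩⟩
  have h := SchwartzMap.one_add_le_sup_seminorm_apply (𝕜 := ℂ) (m := (N, 0)) (k := N) (n := 0)
    le_rfl le_rfl ψ y
  rw [norm_iteratedFDeriv_zero] at h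
  exact h

theorem eq_pow_smul_inv_pow_smul (N : ℕ) (f : E n → Y) :
    f = fun x => (1 + ‖x‖) ^ N • ((1 + ‖x‖) ^ N)⁻¹ • f x := by
  ext x
  have hpos : (1 + ‖x‖) ^ N ≠ 0 := by positivity
  simp [smul_smul, hpos]

theorem PolyIntegrable.locallyIntegrable {f : E n → Y} (hf : PolyIntegrable f) :
    LocallyIntegrable f volume := by
  obtain ⟨N, hN⟩ := hf
  rw [eq_pow_smul_inv_pow_smul N f]
  refine locallyIntegrable_iff.2 fun K hK => ?_
  exact hN.integrableOn.continuousOn_smul (by fun_prop) hK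

theorem PolyIntegrable.aestronglyMeasurable {f : E n → Y} (hf : PolyIntegrable f) :
    AEStronglyMeasurable f volume := hf.locallyIntegrable.aestronglyMeasurable

/-- A function of polynomial growth is determined almost everywhere by its tempered
distribution. -/
theorem PolyIntegrable.ae_eq [CompleteSpace Y] {f g : E n → Y} (hf : PolyIntegrable f)
    (hg : PolyIntegrable g)
    (h : ∀ ψ : 𝓢(E n, ℂ), ∫ x, ψ x • f x = ∫ x, ψ x • g x) : f =ᵐ[volume] g := by
  refine ae_eq_of_integral_contDiff_smul_eq hf.locallyIntegrable hg.locallyIntegrable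
    fun φ hφ hφc => ?_
  have h1 : HasCompactSupport fun x => (φ x : ℂ) :=
    hφc.comp_left (g := fun t : ℝ => (t : ℂ)) Complex.ofReal_zero
  have h2 : ContDiff ℝ (⊤ : ℕ∞) fun x => (φ x : ℂ) := Complex.ofRealCLM.contDiff.comp hφ
  simpa using h (h1.toSchwartzMap h2)

theorem one_add_norm_pow_le (N : ℕ) (x y : E n) :
    (1 + ‖x‖) ^ N ≤ (1 + ‖y‖) ^ N * (1 + ‖x - y‖) ^ N := by
  rw [← mul_pow]
  gcongr
  have h1 : ‖x‖ ≤ ‖y‖ + ‖x - y‖ := by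
    calc ‖x‖ = ‖y + (x - y)‖ := by congr 1; abel
      _ ≤ _ := norm_add_le _ _
  nlinarith [norm_nonneg y, norm_nonneg (x - y), mul_nonneg (norm_nonneg y) (norm_nonneg (x - y))]

/-- The convolution with a rapidly decaying function exists at every point. -/
theorem PolyIntegrable.integrable_conv {f : E n → Y} (hf : PolyIntegrable f) {a : E n → ℂ}
    (ha : RapidDecay a) (x : E n) : Integrable fun y => a y • f (x - y) := by
  have hm := hf.aestronglyMeasurable
  obtain ⟨N, hN⟩ := hf
  obtain ⟨C, hC⟩ := ha.bound N
  refine ((hN.norm.comp_sub_left x).const_mul (C * (1 + ‖x‖) ^ N)).mono'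
    (ha.continuous.aestronglyMeasurable.smul
      (hm.comp_quasiMeasurePreserving (quasiMeasurePreserving_sub_left volume x)))
    (.of_forall fun y => ?_)
  have h1 := one_add_norm_pow_le N (x - y) x
  rw [sub_sub_cancel_left, norm_neg] at h1
  have h0 : 0 < (1 + ‖x - y‖) ^ N := by positivity
  rw [norm_smul, norm_smul, norm_inv, Real.norm_of_nonneg h0.le, ← mul_assoc]
  refine mul_le_mul_of_nonneg_right ?_ (norm_nonneg _)
  rw [← div_eq_mul_inv, le_div_iff₀ h0]
  calc ‖a y‖ * (1 + ‖x - y‖) ^ N ≤ ‖a y‖ * ((1 + ‖x‖) ^ N * (1 + ‖y‖) ^ N) := by gcongr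
    _ = (1 + ‖y‖) ^ N * ‖a y‖ * (1 + ‖x‖) ^ N := by ring
    _ ≤ C * (1 + ‖x‖) ^ N := by
      gcongr
      exact hC y

theorem PolyIntegrable.gaussConvExistsAt {f : E n → Y} (hf : PolyIntegrable f) {ζ : ℂ}
    (hζ : 0 < ζ.re) (x : E n) : GaussConvExistsAt ζ f x :=
  hf.integrable_conv (rapidDecay_gaussKernel hζ) x

/-- The integrand of a convolution, divided by a power of `1 + ‖x‖`, is integrable on the product;
this justifies the exchange of integrals in pairings with test functions. -/
theorem PolyIntegrable.exists_integrable_prod {f : E n → Y} (hf : PolyIntegrable f)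
    {a : E n → ℂ} (ha : RapidDecay a) : ∃ N : ℕ, Integrable (fun p : E n × E n =>
      ((1 + ‖p.1‖) ^ N)⁻¹ • a p.2 • f (p.1 - p.2)) (volume.prod volume) := by
  have hm := hf.aestronglyMeasurable
  obtain ⟨N, hN⟩ := hf
  refine ⟨N, ?_⟩
  have hdom := (ha.integrable_pow N).convolution_integrand (ContinuousLinearMap.mul ℝ ℝ) hN.norm
  have hc : Continuous fun p : E n × E n => ((1 + ‖p.1‖) ^ N)⁻¹ :=
    (by fun_prop : Continuous fun p : E n × E n => (1 + ‖p.1‖) ^ N).inv₀ fun x => by positivity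
  refine hdom.mono' (hc.aestronglyMeasurable.smul
    (ha.continuous.aestronglyMeasurable.convolution_integrand
      (ContinuousLinearMap.lsmul ℝ ℂ) hm)) (.of_forall fun p => ?_)
  have h1 := one_add_norm_pow_le N (p.1 - p.2) (-p.2)
  have h2 : (1 + ‖p.1 - p.2‖) ^ N ≤ (1 + ‖p.2‖) ^ N * (1 + ‖p.1‖) ^ N := by simpa using h1
  have h0 : 0 < (1 + ‖p.1 - p.2‖) ^ N := by positivity
  have h0' : 0 < (1 + ‖p.1‖) ^ N := by positivity
  rw [ContinuousLinearMap.mul_apply', norm_smul, norm_smul, norm_smul, norm_inv, norm_inv,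
    Real.norm_of_nonneg h0.le, Real.norm_of_nonneg h0'.le]
  calc ((1 + ‖p.1‖) ^ N)⁻¹ * (‖a p.2‖ * ‖f (p.1 - p.2)‖)
      = ((1 + ‖p.1‖) ^ N)⁻¹ * ((1 + ‖p.1 - p.2‖) ^ N) *
        (‖a p.2‖ * (((1 + ‖p.1 - p.2‖) ^ N)⁻¹ * ‖f (p.1 - p.2)‖)) := by field_simp
    _ ≤ (1 + ‖p.2‖) ^ N * (‖a p.2‖ * (((1 + ‖p.1 - p.2‖) ^ N)⁻¹ * ‖f (p.1 - p.2)‖)) := by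
        refine mul_le_mul_of_nonneg_right ?_ (by positivity)
        rw [inv_mul_le_iff₀ h0', mul_comm]
        exact h2
    _ = _ := by ring

/-- A convolution with a rapidly decaying function is again of polynomial growth. -/
theorem PolyIntegrable.conv {f : E n → Y} (hf : PolyIntegrable f) {a : E n → ℂ}
    (ha : RapidDecay a) : PolyIntegrable fun x => ∫ y, a y • f (x - y) := by
  obtain ⟨N, hN⟩ := hf.exists_integrable_prod ha
  refine ⟨N, hN.integral_prod_left.congr (.of_forall fun x => ?_)⟩
  simp only
  rw [integral_smul]

theorem PolyIntegrable.integral_smul_conv {f : E n → Y} (hf : PolyIntegrable f) {a : E n → ℂ}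
    (ha : RapidDecay a) (ψ : 𝓢(E n, ℂ)) :
    ∫ x, ψ x • ∫ y, a y • f (x - y) = ∫ y, a y • ∫ x, ψ x • f (x - y) := by
  obtain ⟨N, hN⟩ := hf.exists_integrable_prod ha
  obtain ⟨C, hC⟩ := (rapidDecay_schwartz ψ).bound N
  have hint : Integrable (fun p : E n × E n => ψ p.1 • a p.2 • f (p.1 - p.2))
      (volume.prod volume) := by
    have hc : Continuous fun p : E n × E n => (1 + ‖p.1‖) ^ N • ψ p.1 :=
      (by fun_prop : Continuous fun p : E n × E n => (1 + ‖p.1‖) ^ N).smul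
        (ψ.continuous.comp continuous_fst)
    refine (hN.bdd_smul C hc.aestronglyMeasurable (.of_forall fun p => ?_)).congr
      (.of_forall fun p => ?_)
    · rw [norm_smul, Real.norm_of_nonneg (by positivity)]
      exact hC p.1
    · have : (1 + ‖p.1‖) ^ N ≠ 0 := by positivity
      simp only [Pi.smul_apply']
      rw [smul_assoc, smul_comm (ψ p.1) ((1 + ‖p.1‖) ^ N)⁻¹, smul_smul, mul_inv_cancel₀ this,
        one_smul]
  calc ∫ x, ψ x • ∫ y, a y • f (x - y) = ∫ x, ∫ y, ψ x • a y • f (x - y) := by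
        simp_rw [integral_smul]
    _ = ∫ y, ∫ x, ψ x • a y • f (x - y) :=
        integral_integral_swap (f := fun x y => ψ x • a y • f (x - y)) hint
    _ = _ := by
        refine integral_congr_ae (.of_forall fun y => ?_)
        simp only
        rw [← integral_smul]
        simp_rw [smul_comm (ψ _) (a _)]

/-- Fubini's theorem moves an average of translations of `f` to the test function. -/
theorem PolyIntegrable.integral_smul_translate [CompleteSpace Y] {f : E n → Y} (hf : PolyIntegrable f)
    {a : E n → ℂ} (ha : RapidDecay a) (ψ : 𝓢(E n, ℂ)) :
    ∫ y, a y • ∫ x, ψ (x + y) • f x = ∫ x, (∫ y, a y * ψ (x + y)) • f x := by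
  have hm := hf.aestronglyMeasurable
  obtain ⟨N, hN⟩ := hf
  obtain ⟨C, hC⟩ := (rapidDecay_schwartz ψ).bound N
  have hint : Integrable (fun p : E n × E n => (a p.1 * ψ (p.2 + p.1)) • f p.2)
      (volume.prod volume) := by
    have hdom := ((ha.integrable_pow N).mul_prod hN.norm).const_mul C
    have hc : Continuous fun p : E n × E n => a p.1 * ψ (p.2 + p.1) :=
      (ha.continuous.comp continuous_fst).mul
        (ψ.continuous.comp (continuous_snd.add continuous_fst))
    refine hdom.mono' (hc.aestronglyMeasurable.smul hm.comp_snd) (.of_forall fun p => ?_)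
    have h1 := one_add_norm_pow_le N p.2 (-p.1)
    rw [sub_neg_eq_add, norm_neg] at h1
    have h0 : 0 < (1 + ‖p.2‖) ^ N := by positivity
    have h2 : ‖ψ (p.2 + p.1)‖ ≤ C * (1 + ‖p.1‖) ^ N * ((1 + ‖p.2‖) ^ N)⁻¹ := by
      rw [← div_eq_mul_inv, le_div_iff₀ h0]
      calc ‖ψ (p.2 + p.1)‖ * (1 + ‖p.2‖) ^ N
          ≤ ‖ψ (p.2 + p.1)‖ * ((1 + ‖p.1‖) ^ N * (1 + ‖p.2 + p.1‖) ^ N) := by gcongr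
        _ = ((1 + ‖p.2 + p.1‖) ^ N * ‖ψ (p.2 + p.1)‖) * (1 + ‖p.1‖) ^ N := by ring
        _ ≤ C * (1 + ‖p.1‖) ^ N := by
          gcongr
          exact hC _
    rw [norm_smul, norm_mul, norm_smul, norm_inv, Real.norm_of_nonneg h0.le]
    calc _ ≤ ‖a p.1‖ * (C * (1 + ‖p.1‖) ^ N * ((1 + ‖p.2‖) ^ N)⁻¹) * ‖f p.2‖ := by gcongr
      _ = _ := by ring
  calc ∫ y, a y • ∫ x, ψ (x + y) • f x = ∫ y, ∫ x, (a y * ψ (x + y)) • f x := by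
        refine integral_congr_ae (.of_forall fun y => ?_)
        simp only
        rw [← integral_smul]
        simp_rw [smul_smul]
    _ = ∫ x, ∫ y, (a y * ψ (x + y)) • f x :=
        integral_integral_swap (f := fun y x => (a y * ψ (x + y)) • f x) hint
    _ = _ := by simp_rw [integral_smul_const]

theorem lineDeriv_translate (ψ : 𝓢(E n, ℂ)) (a v : E n) :
    ∂_{v} (SchwartzMap.compSubConstCLM ℂ a ψ) = SchwartzMap.compSubConstCLM ℂ a (∂_{v} ψ) := by
  ext x
  rw [SchwartzMap.compSubConstCLM_apply, SchwartzMap.lineDerivOp_apply_eq_fderiv,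
    SchwartzMap.lineDerivOp_apply_eq_fderiv]
  have : (SchwartzMap.compSubConstCLM ℂ a ψ : E n → ℂ) = fun x => ψ (x - a) := rfl
  simp_rw [this, sub_eq_add_neg, fderiv_comp_add_right]

theorem laplacian_translate (ψ : 𝓢(E n, ℂ)) (a : E n) :
    Δ (SchwartzMap.compSubConstCLM ℂ a ψ) = SchwartzMap.compSubConstCLM ℂ a (Δ ψ) := by
  rw [SchwartzMap.laplacian_eq_sum (stdOrthonormalBasis ℝ (E n)),
    SchwartzMap.laplacian_eq_sum (stdOrthonormalBasis ℝ (E n)), map_sum]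
  simp_rw [lineDeriv_translate]

theorem hasLineDerivAt_gaussKernel (ζ : ℂ) (y v : E n) :
    HasLineDerivAt ℝ (gaussKernel ζ)
      (-((inner ℝ y v : ℝ) : ℂ) / (2 * ζ) * gaussKernel ζ y) y v := by
  have h1 : HasLineDerivAt ℝ (fun x : E n => ‖x‖ ^ 2) (2 * inner ℝ y v) y v := by
    simpa using (hasStrictFDerivAt_norm_sq y).hasFDerivAt.hasLineDerivAt v
  have h2 : HasDerivAt (fun t : ℝ => ‖y + t • v‖ ^ 2) (2 * inner ℝ y v) 0 := h1
  have h3 := ((h2.ofReal_comp.neg.div_const (4 * ζ)).cexp).const_mul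
    ((4 * Real.pi * ζ) ^ (-(n : ℂ) / 2))
  refine HasDerivAt.congr_deriv (f := fun t : ℝ => gaussKernel ζ (y + t • v)) h3 ?_
  simp only [Pi.neg_apply, zero_smul, add_zero, gaussKernel]
  push_cast
  ring

theorem integrable_rapidDecay_mul_schwartz {a : E n → ℂ} (ha : RapidDecay a) (φ : 𝓢(E n, ℂ)) :
    Integrable fun y => a y * φ y := by
  obtain ⟨C, hC⟩ := (rapidDecay_schwartz φ).bound 0
  exact ha.integrable.mul_bdd (c := C) φ.continuous.aestronglyMeasurable
    (.of_forall fun y => by simpa using hC y)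

/-- The heat equation `∂χ_ζ/∂ζ = Δ χ_ζ` in weak form. -/
theorem integral_gaussKernelDeriv_mul {ζ : ℂ} (hζ : 0 < ζ.re) (φ : 𝓢(E n, ℂ)) :
    ∫ y, gaussKernelDeriv ζ y * φ y = ∫ y, gaussKernel ζ y * (Δ φ) y := by
  have hζ0 := ne_zero_of_re_pos hζ
  have hK := rapidDecay_gaussKernel (n := n) hζ
  set b := stdOrthonormalBasis ℝ (E n)
  have hin : ∀ v : E n, ‖v‖ = 1 → ∀ y, ‖((inner ℝ y v : ℝ) : ℂ)‖ ≤ 1 + ‖y‖ := by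
    intro v hv y
    rw [Complex.norm_real]
    refine (norm_inner_le_norm _ _).trans ?_
    rw [hv]
    linarith
  have hmul : ∀ v : E n, ‖v‖ = 1 → ∀ a : E n → ℂ, RapidDecay a →
      RapidDecay fun y => -((inner ℝ y v : ℝ) : ℂ) / (2 * ζ) * a y := by
    intro v hv a ha
    refine ⟨Continuous.mul (by fun_prop) ha.continuous, fun N => ?_⟩
    obtain ⟨C, hC⟩ := ha.bound (N + 1)
    refine ⟨‖2 * ζ‖⁻¹ * C, fun y => ?_⟩
    rw [norm_mul, norm_div, norm_neg]
    calc _ ≤ (1 + ‖y‖) ^ N * ((1 + ‖y‖) / ‖2 * ζ‖ * ‖a y‖) := by gcongr; exact hin v hv y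
      _ = ‖2 * ζ‖⁻¹ * ((1 + ‖y‖) ^ (N + 1) * ‖a y‖) := by rw [pow_succ]; ring
      _ ≤ _ := by gcongr; exact hC y
  have hKK : ∀ v : E n, ‖v‖ = 1 → RapidDecay fun y : E n =>
      (((inner ℝ y v : ℝ) : ℂ) ^ 2 / (4 * ζ ^ 2) - 1 / (2 * ζ)) * gaussKernel ζ y := by
    intro v hv
    convert (hmul v hv _ (hmul v hv _ hK)).sub (hK.const_mul (1 / (2 * ζ))) using 2 with y
    ring
  have key : ∀ v : E n, ‖v‖ = 1 → ∫ y, gaussKernel ζ y * (∂_{v} (∂_{v} φ)) y =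
      ∫ y, (((inner ℝ y v : ℝ) : ℂ) ^ 2 / (4 * ζ ^ 2) - 1 / (2 * ζ)) * gaussKernel ζ y * φ y := by
    intro v hv
    have hK1 := hmul v hv _ hK
    have hφ : ∀ (φ : 𝓢(E n, ℂ)) y, HasLineDerivAt ℝ φ ((∂_{v} φ) y) y v := fun φ y => by
      rw [SchwartzMap.lineDerivOp_apply_eq_fderiv]
      exact φ.differentiableAt.hasFDerivAt.hasLineDerivAt v
    have hD : ∀ y, HasLineDerivAt ℝ (fun y => -((inner ℝ y v : ℝ) : ℂ) / (2 * ζ) * gaussKernel ζ y)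
        ((((inner ℝ y v : ℝ) : ℂ) ^ 2 / (4 * ζ ^ 2) - 1 / (2 * ζ)) * gaussKernel ζ y) y v := by
      intro y
      have h1 : HasDerivAt (fun t : ℝ => inner ℝ (y + t • v) v) 1 0 := by
        have : (fun t : ℝ => inner ℝ (y + t • v) v) = fun t : ℝ => inner ℝ y v + t := by
          ext t
          rw [inner_add_left, inner_smul_left, real_inner_self_eq_norm_sq, hv]
          simp
        rw [this]
        exact (hasDerivAt_id 0).const_add _
      have h2 : HasDerivAt (fun t : ℝ => gaussKernel ζ (y + t • v)) _ 0 :=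
        hasLineDerivAt_gaussKernel ζ y v
      have h3 := (h1.ofReal_comp.neg.div_const (2 * ζ)).mul h2
      refine HasDerivAt.congr_deriv (f := fun t : ℝ =>
        -((inner ℝ (y + t • v) v : ℝ) : ℂ) / (2 * ζ) * gaussKernel ζ (y + t • v)) h3 ?_
      simp only [Pi.neg_apply, zero_smul, add_zero]
      push_cast
      field_simp
      ring
    have e1 := integral_bilinear_hasLineDerivAt_right_eq_neg_left_of_integrable
      (μ := (volume : Measure (E n))) (B := ContinuousLinearMap.mul ℝ ℂ)
      (integrable_rapidDecay_mul_schwartz hK1 (∂_{v} φ))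
      (integrable_rapidDecay_mul_schwartz hK (∂_{v} (∂_{v} φ)))
      (integrable_rapidDecay_mul_schwartz hK (∂_{v} φ))
      (fun x _ => hasLineDerivAt_gaussKernel ζ x v) (fun x _ => hφ (∂_{v} φ) x)
    have e2 := integral_bilinear_hasLineDerivAt_right_eq_neg_left_of_integrable
      (μ := (volume : Measure (E n))) (B := ContinuousLinearMap.mul ℝ ℂ)
      (integrable_rapidDecay_mul_schwartz (hKK v hv) φ)
      (integrable_rapidDecay_mul_schwartz hK1 (∂_{v} φ))
      (integrable_rapidDecay_mul_schwartz hK1 φ)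
      (fun x _ => hD x) (fun x _ => hφ φ x)
    simp only [ContinuousLinearMap.mul_apply'] at e1 e2
    rw [e1, e2, neg_neg]
  have hsum : ∀ y, (Δ φ) y = ∑ i, (∂_{b i} (∂_{b i} φ)) y := fun y => by
    rw [SchwartzMap.laplacian_eq_sum b, sum_apply]
  simp_rw [hsum, Finset.mul_sum]
  rw [integral_finsetSum _ fun i _ => integrable_rapidDecay_mul_schwartz hK _]
  simp_rw [fun i => key (b i) (b.norm_eq_one i)]
  rw [← integral_finsetSum]
  · refine integral_congr_ae (.of_forall fun y => ?_)
    simp only [← Finset.sum_mul, Finset.sum_sub_distrib, ← Finset.sum_div]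
    have h1 : ∑ i, ((inner ℝ y (b i) : ℝ) : ℂ) ^ 2 = ((‖y‖ ^ 2 : ℝ) : ℂ) := by
      rw [← b.sum_sq_inner_left y]
      push_cast
      rfl
    rw [h1, gaussKernelDeriv]
    simp
  · intro i _
    exact integrable_rapidDecay_mul_schwartz (hKK (b i) (b.norm_eq_one i)) φ

end Pairing

/-! ### The generator -/

section Generator

variable {n : ℕ} {k : ℝ} {Y : Type*} [NormedAddCommGroup Y] [NormedSpace ℂ Y]
  {Z : Type*} [NormedAddCommGroup Z] [NormedSpace ℂ Z] {U : E n → Z →L[ℂ] Z} {r : Z → E n → Y}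

/-- `r` represents the elements of `Z` by functions of polynomial growth, linearly and injectively
up to null sets, such that `U y` becomes the translation by `y`, and such that `Z` embeds
continuously into the tempered distributions. -/
structure IsFunctionRealization (U : E n → Z →L[ℂ] Z) (r : Z → E n → Y) : Prop where
  poly : ∀ f, PolyIntegrable (r f)
  add : ∀ f g, r (f + g) =ᵐ[volume] fun x => r f x + r g x
  smul : ∀ (c : ℂ) f, r (c • f) =ᵐ[volume] fun x => c • r f x
  translate : ∀ y f, r (U y f) =ᵐ[volume] fun x => r f (x - y)
  bound : ∀ ψ : 𝓢(E n, ℂ), ∃ C : ℝ, ∀ f, ‖f‖ ≤ 1 → ‖∫ x, ψ x • r f x‖ ≤ C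
  injective : ∀ f g, r f =ᵐ[volume] r g → f = g

namespace IsFunctionRealization

/-- The pairing with a test function as a linear map. -/
def pairingLM (hr : IsFunctionRealization U r) (ψ : 𝓢(E n, ℂ)) : Z →ₗ[ℂ] Y where
  toFun f := ∫ x, ψ x • r f x
  map_add' f g := by
    rw [← integral_add ((hr.poly f).integrable_smul ψ) ((hr.poly g).integrable_smul ψ)]
    refine integral_congr_ae ?_
    filter_upwards [hr.add f g] with x hx
    rw [hx, smul_add]
  map_smul' c f := by
    rw [RingHom.id_apply, ← integral_smul]
    refine integral_congr_ae ?_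
    filter_upwards [hr.smul c f] with x hx
    rw [hx, smul_comm]

/-- The pairing `f ↦ ∫ ψ f` with a test function `ψ`, a bounded linear map. -/
def pairing (hr : IsFunctionRealization U r) (ψ : 𝓢(E n, ℂ)) : Z →L[ℂ] Y :=
  (hr.pairingLM ψ).mkContinuousOfExistsBound (by
    obtain ⟨C, hC⟩ := hr.bound ψ
    exact LinearMap.bound_of_ball_bound one_pos C (hr.pairingLM ψ) fun f hf =>
      hC f (mem_ball_zero_iff.1 hf).le)

theorem pairing_apply (hr : IsFunctionRealization U r) (ψ : 𝓢(E n, ℂ)) (f : Z) :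
    hr.pairing ψ f = ∫ x, ψ x • r f x := rfl

theorem pairing_translate (hr : IsFunctionRealization U r) (ψ : 𝓢(E n, ℂ)) (y : E n) (f : Z) :
    hr.pairing ψ (U y f) = ∫ x, ψ x • r f (x - y) := by
  rw [hr.pairing_apply]
  refine integral_congr_ae ?_
  filter_upwards [hr.translate y f] with x hx
  rw [hx]

theorem pairing_translate' (hr : IsFunctionRealization U r) (ψ : 𝓢(E n, ℂ)) (y : E n) (f : Z) :
    hr.pairing ψ (U y f) = ∫ x, ψ (x + y) • r f x := by
  rw [hr.pairing_translate, ← integral_add_right_eq_self _ y]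
  simp

theorem eq_of_pairing [CompleteSpace Y] (hr : IsFunctionRealization U r) {f g : Z}
    (h : ∀ ψ, hr.pairing ψ f = hr.pairing ψ g) : f = g :=
  hr.injective f g ((hr.poly f).ae_eq (hr.poly g) h)

theorem pairing_convOp [CompleteSpace Y] [CompleteSpace Z]
    (hr : IsFunctionRealization U r) (hU : IsWeightedTranslation k U)
    {a : E n → ℂ} (ha : RapidDecay a) (ψ : 𝓢(E n, ℂ)) (f : Z) :
    hr.pairing ψ (hU.convOp a (ha.weightedIntegrable k) f) =
      ∫ y, a y • hr.pairing ψ (U y f) := by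
  rw [hU.convOp_apply, ← (hr.pairing ψ).integral_comp_comm
    (hU.integrable_smul (ha.weightedIntegrable k) f)]
  simp_rw [map_smul]

/-- The Bochner integral in `Z` that defines `G(ζ) f` is represented by the pointwise
convolution. -/
theorem ae_eq_gaussConv [CompleteSpace Y] [CompleteSpace Z]
    (hr : IsFunctionRealization U r) (hU : IsWeightedTranslation k U) {ζ : ℂ}
    (hζ : 0 < ζ.re) (f : Z) : r (hU.gaussOp ζ f) =ᵐ[volume] gaussConv ζ (r f) := by
  have hK := rapidDecay_gaussKernel (n := n) hζ
  refine (hr.poly _).ae_eq ((hr.poly f).conv hK) fun ψ => ?_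
  change _ = ∫ x, ψ x • ∫ y, gaussKernel ζ y • r f (x - y)
  rw [(hr.poly f).integral_smul_conv hK ψ, hU.gaussOp_of_pos hζ, ← hr.pairing_apply,
    hr.pairing_convOp hU hK]
  simp_rw [hr.pairing_translate]

theorem pairing_convOp_eq [CompleteSpace Y] [CompleteSpace Z]
    (hr : IsFunctionRealization U r) (hU : IsWeightedTranslation k U)
    {a : E n → ℂ} (ha : RapidDecay a) (ψ : 𝓢(E n, ℂ)) (f : Z) :
    hr.pairing ψ (hU.convOp a (ha.weightedIntegrable k) f) =
      ∫ x, (∫ y, a y * ψ (x + y)) • r f x := by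
  rw [hr.pairing_convOp hU ha, ← (hr.poly f).integral_smul_translate ha ψ]
  simp_rw [hr.pairing_translate']

/-- In the weak sense, `G(s) f` solves the heat equation. -/
theorem hasDerivAt_pairing [CompleteSpace Y] [CompleteSpace Z]
    (hr : IsFunctionRealization U r) (hU : IsWeightedTranslation k U)
    (ψ : 𝓢(E n, ℂ)) (f : Z) {s : ℝ} (hs : 0 < s) :
    HasDerivAt (fun t : ℝ => hr.pairing ψ (hU.gaussOp (t : ℂ) f))
      (hr.pairing (Δ ψ) (hU.gaussOp (s : ℂ) f)) s := by
  have hs' : 0 < (s : ℂ).re := by simpa using hs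
  have hK := rapidDecay_gaussKernel (n := n) hs'
  have hK' := rapidDecay_gaussKernelDeriv (n := n) hs'
  have h1 : HasDerivAt (fun t : ℝ => hU.gaussOp (t : ℂ)) (hU.convOp (gaussKernelDeriv (s : ℂ))
      (hK'.weightedIntegrable k)) s := by
    simpa [Function.comp_def] using ((hU.hasDerivAt_gaussOp hs').hasFDerivAt.restrictScalars ℝ).comp_hasDerivAt s
      Complex.ofRealCLM.hasDerivAt
  have h2 : HasDerivAt (fun t : ℝ => hU.gaussOp (t : ℂ) f) (hU.convOp (gaussKernelDeriv (s : ℂ))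
      (hK'.weightedIntegrable k) f) s := by
    simpa [Function.comp_def] using (((ContinuousLinearMap.apply ℂ Z f).restrictScalars ℝ).hasFDerivAt.comp_hasDerivAt s
      h1)
  have h3 : HasDerivAt (fun t : ℝ => hr.pairing ψ (hU.gaussOp (t : ℂ) f))
      (hr.pairing ψ (hU.convOp (gaussKernelDeriv (s : ℂ)) (hK'.weightedIntegrable k) f)) s :=
    ((hr.pairing ψ).restrictScalars ℝ).hasFDerivAt.comp_hasDerivAt s h2
  refine h3.congr_deriv ?_
  rw [hU.gaussOp_of_pos hs', hr.pairing_convOp_eq hU hK', hr.pairing_convOp_eq hU hK]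
  refine integral_congr_ae (.of_forall fun x => ?_)
  have h4 := integral_gaussKernelDeriv_mul hs' (SchwartzMap.compSubConstCLM ℂ (-x) ψ)
  simp only [laplacian_translate, SchwartzMap.compSubConstCLM_apply, sub_neg_eq_add] at h4
  simp only [add_comm x]
  rw [h4]

theorem continuousOn_pairing [CompleteSpace Z] (hr : IsFunctionRealization U r) (hU : IsWeightedTranslation k U)
    (hk : 0 ≤ k) (ψ : 𝓢(E n, ℂ)) (f : Z) :
    ContinuousOn (fun t : ℝ => hr.pairing ψ (hU.gaussOp (t : ℂ) f)) (Ici 0) :=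
  (hr.pairing ψ).continuous.comp_continuousOn (hU.continuousOn_gaussOp_ofReal hk f)

theorem isLaplacianAt_iff (hr : IsFunctionRealization U r) (f h : Z) :
    IsLaplacianAt (fun f => toTempered (r f) (hr.poly f)) f h ↔
      ∀ ψ, hr.pairing (Δ ψ) f = hr.pairing ψ h := by
  unfold IsLaplacianAt
  refine ⟨fun H ψ => ?_, fun H => ?_⟩
  · have := DFunLike.congr_fun H ψ
    rwa [TemperedDistribution.laplacian_apply_apply] at this
  · ext ψ
    rw [TemperedDistribution.laplacian_apply_apply]
    exact H ψ

/-- The derivative of `⟨G(t) f, ψ⟩` for `t > 0` is `⟨G(t) f, Δ ψ⟩`, and has the limit `⟨f, Δ ψ⟩` as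
`t ↓ 0`; so this is the right derivative at `0`, which is also `⟨h, ψ⟩`. -/
theorem isLaplacianAt_of_isGeneratorAt [CompleteSpace Y] [CompleteSpace Z]
    (hr : IsFunctionRealization U r)
    (hU : IsWeightedTranslation k U) (hk : 0 ≤ k) {f h : Z}
    (H : IsGeneratorAt (fun t : ℝ => hU.gaussOp t) f h) (ψ : 𝓢(E n, ℂ)) :
    hr.pairing (Δ ψ) f = hr.pairing ψ h := by
  set u : ℝ → Y := fun t => hr.pairing ψ (hU.gaussOp (t : ℂ) f) with hu
  have hu0 : u 0 = hr.pairing ψ f := by simp [hu, hU.gaussOp_zero]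
  have h1 : HasDerivWithinAt u (hr.pairing (Δ ψ) f) (Ici 0) 0 := by
    refine hasDerivWithinAt_Ici_of_tendsto_deriv (s := Ioi 0)
      (fun s hs => (hr.hasDerivAt_pairing hU ψ f hs).differentiableAt.differentiableWithinAt)
      ((hr.continuousOn_pairing hU hk ψ f 0 self_mem_Ici).mono Ioi_subset_Ici_self)
      self_mem_nhdsWithin ?_
    have h2 := (hr.continuousOn_pairing hU hk (Δ ψ) f 0 self_mem_Ici).mono Ioi_subset_Ici_self
    have h3 : Tendsto (fun t : ℝ => hr.pairing (Δ ψ) (hU.gaussOp (t : ℂ) f)) (𝓝[>] 0)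
        (𝓝 (hr.pairing (Δ ψ) f)) := by
      simpa [ContinuousWithinAt, hU.gaussOp_zero] using h2
    refine h3.congr' ?_
    filter_upwards [self_mem_nhdsWithin] with s hs
    exact (hr.hasDerivAt_pairing hU ψ f hs).deriv.symm
  have h4 : Tendsto (fun t : ℝ => t⁻¹ • (u t - u 0)) (𝓝[>] 0) (𝓝 (hr.pairing (Δ ψ) f)) := by
    have := (hasDerivWithinAt_iff_tendsto_slope' self_notMem_Ioi).1 h1.Ioi_of_Ici
    exact this.congr fun t => by simp [slope_def_module]
  have h5 := ((hr.pairing ψ).continuous.tendsto h).comp H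
  refine tendsto_nhds_unique h4 (h5.congr fun t => ?_)
  rw [Function.comp_apply, map_smul, map_sub, Complex.coe_smul, hu0]

/-- Testing against all `ψ` gives `G(t) f - f = ∫₀ᵗ G(s) h ds` in `Z`, which is differentiable at
`0` with derivative `h`. -/
theorem isGeneratorAt_of_pairing [CompleteSpace Y] [CompleteSpace Z]
    (hr : IsFunctionRealization U r)
    (hU : IsWeightedTranslation k U) (hk : 0 ≤ k) {f h : Z}
    (H : ∀ ψ, hr.pairing (Δ ψ) f = hr.pairing ψ h) :
    IsGeneratorAt (fun t : ℝ => hU.gaussOp t) f h := by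
  -- The hypothesis carries over to `G(s) f` and `G(s) h`, as both sides commute with translations.
  have H' : ∀ ψ (s : ℝ), 0 < s → hr.pairing (Δ ψ) (hU.gaussOp (s : ℂ) f) =
      hr.pairing ψ (hU.gaussOp (s : ℂ) h) := by
    intro ψ s hs
    have hs' : 0 < (s : ℂ).re := by simpa using hs
    have hK := rapidDecay_gaussKernel (n := n) hs'
    rw [hU.gaussOp_of_pos hs', hr.pairing_convOp hU hK, hr.pairing_convOp hU hK]
    refine integral_congr_ae (.of_forall fun y => ?_)
    simp only
    have := H (SchwartzMap.compSubConstCLM ℂ (-y) ψ)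
    rw [laplacian_translate, hr.pairing_apply, hr.pairing_apply] at this
    simp only [SchwartzMap.compSubConstCLM_apply, sub_neg_eq_add] at this
    rw [hr.pairing_translate', hr.pairing_translate', this]
  -- The orbit of `h`, continued to negative times by a constant so that it is continuous on `ℝ`.
  set q : ℝ → Z := fun s => hU.gaussOp ((max s 0 : ℝ) : ℂ) h with hq
  have hqc : Continuous q :=
    (hU.continuousOn_gaussOp_ofReal hk h).comp_continuous (f := fun s : ℝ => max s 0)
      (by fun_prop) fun s => le_max_right s 0
  have hqs : ∀ s : ℝ, 0 ≤ s → q s = hU.gaussOp (s : ℂ) h := fun s hs => by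
    simp only [hq, max_eq_left hs]
  have hint : ∀ t : ℝ, 0 < t → hU.gaussOp (t : ℂ) f - f = ∫ s in (0 : ℝ)..t, q s := by
    intro t ht
    refine hr.eq_of_pairing fun ψ => ?_
    have e1 := intervalIntegral.integral_eq_sub_of_hasDerivAt_of_le
      (f := fun s : ℝ => hr.pairing ψ (hU.gaussOp (s : ℂ) f)) (f' := fun s => hr.pairing ψ (q s))
      ht.le ((hr.continuousOn_pairing hU hk ψ f).mono Icc_subset_Ici_self)
      (fun s hs => (hr.hasDerivAt_pairing hU ψ f hs.1).congr_deriv (by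
        rw [H' ψ s hs.1, hqs s hs.1.le]))
      (((hr.pairing ψ).continuous.comp hqc).intervalIntegrable 0 t)
    rw [← (hr.pairing ψ).intervalIntegral_comp_comm (hqc.intervalIntegrable 0 t), e1]
    simp [hU.gaussOp_zero]
  have h1 := (hqc.integral_hasStrictDerivAt 0 0).hasDerivAt
  have h2 : Tendsto (fun t : ℝ => t⁻¹ • ∫ s in (0 : ℝ)..t, q s) (𝓝[>] 0) (𝓝 h) := by
    have := (hasDerivWithinAt_iff_tendsto_slope' self_notMem_Ioi).1
      (h1.hasDerivWithinAt (s := Ioi 0))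
    have hq0 : q 0 = h := by simp [hqs 0 le_rfl, hU.gaussOp_zero]
    rw [hq0] at this
    exact this.congr fun t => by simp [slope_def_module]
  refine h2.congr' ?_
  filter_upwards [self_mem_nhdsWithin] with t ht
  simp only [Complex.coe_smul]
  rw [hint t ht]

/-- The generator of the Gauss semigroup is the maximal distributional Laplacian. -/
theorem isGeneratorAt_iff [CompleteSpace Y] [CompleteSpace Z]
    (hr : IsFunctionRealization U r)
    (hU : IsWeightedTranslation k U) (hk : 0 ≤ k) (f h : Z) :
    IsGeneratorAt (fun t : ℝ => hU.gaussOp t) f h ↔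
      IsLaplacianAt (fun f => toTempered (r f) (hr.poly f)) f h := by
  rw [hr.isLaplacianAt_iff]
  exact ⟨hr.isLaplacianAt_of_isGeneratorAt hU hk, hr.isGeneratorAt_of_pairing hU hk⟩

end IsFunctionRealization

end Generator

/-! ### Weighted translations of functions -/

section WeightedTranslate

variable {n : ℕ} {k : ℝ} {Y : Type*} [NormedAddCommGroup Y] [NormedSpace ℂ Y]

/-- The translation `(τ_y f)(x) = f (x - y)` of `f = w g`, expressed on `g`:
`x ↦ (w (x - y) / w x) g (x - y)`. -/
def weightedTranslate (k : ℝ) (y : E n) (g : E n → Y) (x : E n) : Y :=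
  (weight k (x - y) / weight k x) • g (x - y)

theorem weight_smul_weightedTranslate (y : E n) (g : E n → Y) (x : E n) :
    weight k x • weightedTranslate k y g x = weight k (x - y) • g (x - y) := by
  rw [weightedTranslate, smul_smul, mul_div_cancel₀ _ (weight_pos k x).ne']

theorem weightedTranslate_zero (g : E n → Y) : weightedTranslate k 0 g = g := by
  ext x
  simp [weightedTranslate, (weight_pos k x).ne']

theorem weightedTranslate_weightedTranslate (y z : E n) (g : E n → Y) :
    weightedTranslate k y (weightedTranslate k z g) = weightedTranslate k (y + z) g := by
  ext x
  simp only [weightedTranslate, smul_smul, sub_sub]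
  congr 1
  have h1 := (weight_pos k x).ne'
  have h2 := (weight_pos k (x - y)).ne'
  field_simp

theorem weightedTranslate_add (y : E n) (g h : E n → Y) (x : E n) :
    weightedTranslate k y (fun x => g x + h x) x =
      weightedTranslate k y g x + weightedTranslate k y h x := by
  simp [weightedTranslate]

theorem weightedTranslate_smul (y : E n) (c : ℂ) (g : E n → Y) (x : E n) :
    weightedTranslate k y (fun x => c • g x) x = c • weightedTranslate k y g x :=
  smul_comm _ _ _

theorem weight_neg (y : E n) : weight k (-y) = weight k y := by simp [weight]

theorem weight_add_le (hk : 0 ≤ k) (x y : E n) : weight k (x + y) ≤ weight k x * weight k y := by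
  unfold weight
  rw [← Real.mul_rpow (by positivity) (by positivity)]
  refine Real.rpow_le_rpow (by positivity) ?_ hk
  nlinarith [norm_add_le x y, mul_nonneg (norm_nonneg x) (norm_nonneg y)]

theorem weight_ratio_le (hk : 0 ≤ k) (x y : E n) :
    weight k (x - y) / weight k x ≤ weight k y := by
  rw [div_le_iff₀ (weight_pos k x), mul_comm, sub_eq_add_neg, ← weight_neg y]
  exact weight_add_le hk x (-y)

theorem abs_weight_ratio_sub_one_le (hk : 0 ≤ k) (x y : E n) :
    |weight k (x - y) / weight k x - 1| ≤ weight k y - 1 := by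
  have hw := one_le_weight hk y
  have h2 : weight k x ≤ weight k (x - y) * weight k y := by
    simpa using weight_add_le hk (x - y) y
  have h3 : 2 - weight k y ≤ weight k (x - y) / weight k x := by
    rw [le_div_iff₀ (weight_pos k x)]
    have hx := weight_pos k (x - y)
    have h4 : (2 - weight k y) * weight k y ≤ 1 := by nlinarith [sq_nonneg (weight k y - 1)]
    rcases le_total (2 - weight k y) 0 with h | h
    · exact (mul_nonpos_of_nonpos_of_nonneg h (weight_pos k x).le).trans hx.le
    · calc _ ≤ (2 - weight k y) * (weight k (x - y) * weight k y) := by gcongr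
        _ = ((2 - weight k y) * weight k y) * weight k (x - y) := by ring
        _ ≤ 1 * weight k (x - y) := by gcongr
        _ = _ := one_mul _
  rw [abs_le]
  constructor
  · linarith
  · linarith [weight_ratio_le hk x y]

theorem norm_weightedTranslate_le (hk : 0 ≤ k) (y : E n) (g : E n → Y) (x : E n) :
    ‖weightedTranslate k y g x‖ ≤ weight k y * ‖g (x - y)‖ := by
  rw [weightedTranslate, norm_smul, Real.norm_of_nonneg
    (div_pos (weight_pos k _) (weight_pos k _)).le]
  exact mul_le_mul_of_nonneg_right (weight_ratio_le hk x y) (norm_nonneg _)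

theorem norm_weightedTranslate_sub_le (hk : 0 ≤ k) (y : E n) (g : E n → Y) (x : E n) :
    ‖weightedTranslate k y g x - g (x - y)‖ ≤ (weight k y - 1) * ‖g (x - y)‖ := by
  have : weightedTranslate k y g x - g (x - y) =
      (weight k (x - y) / weight k x - 1) • g (x - y) := by
    rw [weightedTranslate, sub_smul, one_smul]
  rw [this, norm_smul, Real.norm_eq_abs]
  exact mul_le_mul_of_nonneg_right (abs_weight_ratio_sub_one_le hk x y) (norm_nonneg _)

theorem continuous_weight_ratio (y : E n) :
    Continuous fun x => weight k (x - y) / weight k x :=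
  ((continuous_weight k).comp (by fun_prop)).div (continuous_weight k)
    fun x => (weight_pos k x).ne'

theorem continuous_weightedTranslate (y : E n) {g : E n → Y} (hg : Continuous g) :
    Continuous (weightedTranslate k y g) :=
  (continuous_weight_ratio y).smul (hg.comp (by fun_prop))

theorem tendsto_weight_sub_one : Tendsto (fun y : E n => weight k y - 1) (𝓝 0) (𝓝 0) := by
  have := (continuous_weight k).tendsto (0 : E n)
  simpa [weight] using this.sub_const 1

theorem uniformContinuous_smul_of_bounded {m : E n → ℝ} {g : E n → Y} (hm : UniformContinuous m)
    (hg : UniformContinuous g) {A B : ℝ} (hA : ∀ x, |m x| ≤ A) (hB : ∀ x, ‖g x‖ ≤ B) :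
    UniformContinuous fun x => m x • g x := by
  have h1 := tendsto_uniformity_iff_dist_tendsto_zero.1 hm
  have h2 := tendsto_uniformity_iff_dist_tendsto_zero.1 hg
  refine tendsto_uniformity_iff_dist_tendsto_zero.2 (squeeze_zero (fun _ => dist_nonneg)
    (fun p => ?_) (by simpa using (h1.mul_const B).add (h2.const_mul A)))
  simp only [dist_eq_norm]
  have : m p.1 • g p.1 - m p.2 • g p.2 = (m p.1 - m p.2) • g p.1 + m p.2 • (g p.1 - g p.2) := by
    rw [sub_smul, smul_sub]
    abel
  rw [this]
  refine (norm_add_le _ _).trans ?_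
  rw [norm_smul, norm_smul]
  gcongr
  · exact hB _
  · exact hA _

/-- The ratio `w (x - y) / w x` is not affected much by a small step in `x`, because each of the
quotients of weights at neighbouring points is close to `1`. -/
theorem uniformContinuous_weight_ratio (hk : 0 ≤ k) (y : E n) :
    UniformContinuous fun x => weight k (x - y) / weight k x := by
  have h1 : Tendsto (fun p : E n × E n => p.2 - p.1) (uniformity (E n)) (𝓝 0) := by
    rw [tendsto_zero_iff_norm_tendsto_zero]
    have := tendsto_uniformity_iff_dist_tendsto_zero.1 (uniformContinuous_id (α := E n))
    simpa [dist_eq_norm, norm_sub_rev] using this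
  have h2 : Tendsto (fun h : E n => 2 * weight k y * (weight k h - 1)) (𝓝 0) (𝓝 0) := by
    simpa using tendsto_weight_sub_one.const_mul (2 * weight k y)
  have h3 : Tendsto (fun h : E n => weight k h * (2 * weight k y * (weight k h - 1))) (𝓝 0)
      (𝓝 0) := by
    simpa using ((continuous_weight k).tendsto (0 : E n)).mul h2
  refine tendsto_uniformity_iff_dist_tendsto_zero.2 (squeeze_zero (fun _ => dist_nonneg)
    (fun p => ?_) (h3.comp h1))
  obtain ⟨x, x'⟩ := p
  simp only [Function.comp_apply]
  set h := x' - x with hh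
  have hx : x = x' - h := by rw [hh]; abel
  have a1 := abs_weight_ratio_sub_one_le hk x' h
  have a2 := abs_weight_ratio_sub_one_le hk (x' - y) h
  have a3 := weight_ratio_le hk x' y
  have a4 : 1 ≤ weight k h := one_le_weight hk h
  have a5 : weight k x' / weight k x ≤ weight k h := by
    rw [div_le_iff₀ (weight_pos k x)]
    simpa [hh, mul_comm] using weight_add_le hk x h
  rw [← hx] at a1
  have e0 : x' - y - h = x - y := by rw [hh]; abel
  rw [e0] at a2
  have p1 := weight_pos k x
  have p2 := weight_pos k x'
  have p3 := weight_pos k (x - y)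
  have p4 := weight_pos k (x' - y)
  have py := weight_pos k y
  -- The quotient of the ratios at the two points is a quotient of two ratios with step `h`.
  have key : weight k (x - y) / weight k x - weight k (x' - y) / weight k x' =
      (weight k x' / weight k x) * (weight k (x' - y) / weight k x') *
        ((weight k (x - y) / weight k (x' - y) - 1) - (weight k x / weight k x' - 1)) := by
    field_simp
    ring
  rw [Real.dist_eq, key, abs_mul, abs_mul, abs_of_pos (div_pos p2 p1), abs_of_pos (div_pos p4 p2)]
  calc _ ≤ weight k h * weight k y * ((weight k h - 1) + (weight k h - 1)) := by
        gcongr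
        exact (abs_sub _ _).trans (add_le_add a2 a1)
    _ = _ := by ring

theorem uniformContinuous_weightedTranslate (hk : 0 ≤ k) (y : E n) {g : E n → Y}
    (hg : UniformContinuous g) {B : ℝ} (hB : ∀ x, ‖g x‖ ≤ B) :
    UniformContinuous (weightedTranslate k y g) := by
  have h : UniformContinuous fun x : E n => x - y := uniformContinuous_id.sub uniformContinuous_const
  refine uniformContinuous_smul_of_bounded (A := weight k y) (B := B)
    (uniformContinuous_weight_ratio hk y) (hg.comp h)
    (fun x => ?_) fun x => hB _
  rw [abs_of_pos (div_pos (weight_pos k _) (weight_pos k _))]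
  exact weight_ratio_le hk x y

/-- Weighted translations of bounded uniformly continuous functions are strongly continuous for
the sup norm. -/
theorem eventually_norm_weightedTranslate_sub_le (hk : 0 ≤ k) {g : E n → Y}
    (hg : UniformContinuous g) {B : ℝ} (hB : ∀ x, ‖g x‖ ≤ B) {ε : ℝ} (hε : 0 < ε) :
    ∀ᶠ y in 𝓝 (0 : E n), ∀ x, ‖weightedTranslate k y g x - g x‖ ≤ ε := by
  obtain ⟨δ, hδ, hδ'⟩ := Metric.uniformContinuous_iff.1 hg (ε / 2) (by positivity)
  have h1 : Tendsto (fun y : E n => (weight k y - 1) * B) (𝓝 0) (𝓝 0) := by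
    simpa using tendsto_weight_sub_one.mul_const B
  filter_upwards [h1.eventually (gt_mem_nhds (by positivity : (0 : ℝ) < ε / 2)),
    Metric.ball_mem_nhds (0 : E n) hδ] with y hy1 hy2 x
  have h2 : ‖g (x - y) - g x‖ < ε / 2 := by
    rw [← dist_eq_norm]
    refine hδ' ?_
    rw [dist_eq_norm]
    simpa using hy2
  have h3 : ‖weightedTranslate k y g x - g (x - y)‖ ≤ (weight k y - 1) * B := by
    refine (norm_weightedTranslate_sub_le hk y g x).trans ?_
    refine mul_le_mul_of_nonneg_left (hB _) ?_
    linarith [one_le_weight hk y]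
  calc _ = ‖(weightedTranslate k y g x - g (x - y)) + (g (x - y) - g x)‖ := by congr 1; abel
    _ ≤ _ := norm_add_le _ _
    _ ≤ ε := by linarith

/-- A bound for the pairing with a test function that is uniform in the function. -/
theorem norm_integral_smul_le_of_le_weight (k : ℝ) (ψ : 𝓢(E n, ℂ)) :
    ∃ C : ℝ, ∀ (f : E n → Y) (u : E n → ℝ), (∀ x, 0 ≤ u x) → Integrable u → ∫ x, u x ≤ 1 →
      (∀ᵐ x, ‖f x‖ ≤ weight k x * (1 + u x)) → ‖∫ x, ψ x • f x‖ ≤ C := by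
  have hψ := rapidDecay_schwartz ψ
  obtain ⟨D, hD⟩ := hψ.bound ⌈|k|⌉₊
  have hD0 : 0 ≤ D := (by positivity : (0 : ℝ) ≤ _).trans (hD 0)
  refine ⟨(∫ x, weight k x * ‖ψ x‖) + D * 1, fun f u hu0 hu hu1 hf => ?_⟩
  have hint := (hψ.integrable_weight k).add (hu.const_mul D)
  refine (norm_integral_le_of_norm_le hint ?_).trans ?_
  · filter_upwards [hf] with x hx
    have h1 : weight k x * ‖ψ x‖ ≤ D :=
      (mul_le_mul_of_nonneg_right (weight_le_pow k x) (norm_nonneg _)).trans (hD x)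
    rw [norm_smul]
    calc ‖ψ x‖ * ‖f x‖ ≤ ‖ψ x‖ * (weight k x * (1 + u x)) := by gcongr
      _ = weight k x * ‖ψ x‖ + (weight k x * ‖ψ x‖) * u x := by ring
      _ ≤ weight k x * ‖ψ x‖ + D * u x := by
        gcongr
        exact hu0 x
  · simp only [Pi.add_apply]
    rw [integral_add (hψ.integrable_weight k) (hu.const_mul D), integral_const_mul]
    gcongr

end WeightedTranslate

/-! ### Transport to the image space -/

section Transport

variable {n : ℕ} {k : ℝ} {X F : Type*} [NormedAddCommGroup X] [NormedSpace ℂ X] [AddCommGroup F]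
  [Module ℂ F]

/-- An operator on `X`, carried over to the image of `X` under `T`. -/
def NormedImage.conj (T : X →ₗ[ℂ] F) (hT : Function.Injective T) (A : X →L[ℂ] X) :
    NormedImage T hT →L[ℂ] NormedImage T hT :=
  ((isometryEquiv T hT).toContinuousLinearEquiv : X →L[ℂ] NormedImage T hT).comp
    (A.comp ((isometryEquiv T hT).symm.toContinuousLinearEquiv : NormedImage T hT →L[ℂ] X))

theorem NormedImage.conj_equiv (T : X →ₗ[ℂ] F) (hT : Function.Injective T) (A : X →L[ℂ] X)
    (g : X) : NormedImage.conj T hT A (equiv T hT g) = equiv T hT (A g) := by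
  change equiv T hT (A ((isometryEquiv T hT).symm (isometryEquiv T hT g))) = _
  rw [LinearIsometryEquiv.symm_apply_apply]

theorem IsWeightedTranslation.normedImage {V : E n → X →L[ℂ] X} (hV : IsWeightedTranslation k V)
    (T : X →ₗ[ℂ] F) (hT : Function.Injective T) :
    IsWeightedTranslation k fun y => NormedImage.conj T hT (V y) where
  map_zero := by
    ext f
    obtain ⟨g, rfl⟩ := (NormedImage.equiv T hT).surjective f
    rw [NormedImage.conj_equiv, hV.map_zero]
    rfl
  map_add x y := by
    ext f
    obtain ⟨g, rfl⟩ := (NormedImage.equiv T hT).surjective f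
    rw [ContinuousLinearMap.comp_apply, NormedImage.conj_equiv, NormedImage.conj_equiv,
      NormedImage.conj_equiv, hV.map_add]
    rfl
  norm_le y := by
    refine ContinuousLinearMap.opNorm_le_bound _ (weight_pos k y).le fun f => ?_
    obtain ⟨g, rfl⟩ := (NormedImage.equiv T hT).surjective f
    rw [NormedImage.conj_equiv, NormedImage.norm_equiv, NormedImage.norm_equiv]
    exact hV.norm_apply_le y g
  tendsto_zero f := by
    obtain ⟨g, rfl⟩ := (NormedImage.equiv T hT).surjective f
    have h := ((NormedImage.isometryEquiv T hT).continuous.tendsto g).comp (hV.tendsto_zero g)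
    refine h.congr fun y => ?_
    rw [NormedImage.conj_equiv]
    rfl

/-- A bounded linear map, such as the evaluation at a point, passes under the Bochner integral
that defines `G(ζ) f`. -/
theorem IsWeightedTranslation.apply_gaussOp {Y Z : Type*} [NormedAddCommGroup Y]
    [NormedSpace ℂ Y] [CompleteSpace Y] [NormedAddCommGroup Z] [NormedSpace ℂ Z] [CompleteSpace Z]
    {U : E n → Z →L[ℂ] Z} (hU : IsWeightedTranslation k U) {ζ : ℂ} (hζ : 0 < ζ.re) (f : Z)
    (ev : Z →L[ℂ] Y) {φ : E n → Y} {x : E n} (h : ∀ y, ev (U y f) = φ (x - y)) :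
    ev (hU.gaussOp ζ f) = gaussConv ζ φ x := by
  rw [hU.gaussOp_apply hζ, ← ev.integral_comp_comm
    (hU.integrable_smul ((rapidDecay_gaussKernel hζ).weightedIntegrable k) f), gaussConv]
  simp_rw [map_smul, h]

end Transport

/-! ### Bounded uniformly continuous functions -/

section BUCSpace

variable {n : ℕ} {k : ℝ} {Y : Type*} [NormedAddCommGroup Y] [NormedSpace ℂ Y]

/-- The weighted translation of a bounded uniformly continuous function. -/
def translateBUC (hk : 0 ≤ k) (y : E n) (g : BUC n Y) : BUC n Y :=
  ⟨BoundedContinuousFunction.ofNormedAddCommGroup (weightedTranslate k y g.1)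
    (continuous_weightedTranslate y g.1.continuous) (weight k y * ‖g‖) fun x =>
      (norm_weightedTranslate_le hk y g.1 x).trans
        (mul_le_mul_of_nonneg_left (g.1.norm_coe_le_norm _) (weight_pos k y).le),
    uniformContinuous_weightedTranslate hk y g.2 g.1.norm_coe_le_norm⟩

theorem norm_translateBUC_le (hk : 0 ≤ k) (y : E n) (g : BUC n Y) :
    ‖translateBUC hk y g‖ ≤ weight k y * ‖g‖ :=
  (BoundedContinuousFunction.norm_le (mul_nonneg (weight_pos k y).le (norm_nonneg _))).2 fun x =>
    (norm_weightedTranslate_le hk y g.1 x).trans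
      (mul_le_mul_of_nonneg_left (g.1.norm_coe_le_norm _) (weight_pos k y).le)

/-- The weighted translations as bounded operators on `BUC(ℝⁿ, Y)`. -/
def translateBUCL (hk : 0 ≤ k) (y : E n) : BUC n Y →L[ℂ] BUC n Y :=
  LinearMap.mkContinuous
    { toFun := translateBUC hk y
      map_add' := fun f g => Subtype.ext <| BoundedContinuousFunction.ext fun x =>
        weightedTranslate_add y f.1 g.1 x
      map_smul' := fun c f => Subtype.ext <| BoundedContinuousFunction.ext fun x =>
        weightedTranslate_smul y c f.1 x }
    (weight k y) (norm_translateBUC_le hk y)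

theorem isWeightedTranslation_BUC (hk : 0 ≤ k) :
    IsWeightedTranslation k (translateBUCL hk : E n → BUC n Y →L[ℂ] BUC n Y) where
  map_zero := by
    ext g x
    exact congrFun (weightedTranslate_zero g.1) x
  map_add y z := by
    ext g x
    exact (congrFun (weightedTranslate_weightedTranslate y z g.1) x).symm
  norm_le y := LinearMap.mkContinuous_norm_le _ (weight_pos k y).le _
  tendsto_zero g := by
    refine Metric.tendsto_nhds.2 fun ε hε => ?_
    filter_upwards [eventually_norm_weightedTranslate_sub_le hk g.2 g.1.norm_coe_le_norm
      (by positivity : 0 < ε / 2)] with y hy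
    rw [dist_eq_norm]
    exact ((BoundedContinuousFunction.norm_le (by positivity)).2 hy).trans_lt (by linarith)

theorem mulWeightBUC_translate (hk : 0 ≤ k) (y : E n) (g : BUC n Y) (x : E n) :
    mulWeightBUC n k Y (translateBUCL hk y g) x = mulWeightBUC n k Y g (x - y) :=
  weight_smul_weightedTranslate y g.1 x

/-- The translations on `w BUC(ℝⁿ, Y)`. -/
abbrev translateWBUC (hk : 0 ≤ k) (y : E n) : WBUC n k Y →L[ℂ] WBUC n k Y :=
  NormedImage.conj _ (mulWeightBUC_injective n k Y) (translateBUCL hk y)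

theorem translateWBUC_apply (hk : 0 ≤ k) (y : E n) (f : WBUC n k Y) (x : E n) :
    translateWBUC hk y f x = f (x - y) := by
  obtain ⟨g, rfl⟩ := (NormedImage.equiv _ (mulWeightBUC_injective n k Y)).surjective f
  rw [NormedImage.conj_equiv, NormedImage.incl_equiv, NormedImage.incl_equiv]
  exact mulWeightBUC_translate hk y g x

theorem norm_WBUC_apply_le (f : WBUC n k Y) (x : E n) : ‖f x‖ ≤ weight k x * ‖f‖ := by
  obtain ⟨g, rfl⟩ := (NormedImage.equiv _ (mulWeightBUC_injective n k Y)).surjective f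
  rw [NormedImage.incl_equiv, NormedImage.norm_equiv]
  change ‖weight k x • g.1 x‖ ≤ _
  rw [norm_smul, Real.norm_of_nonneg (weight_pos k x).le]
  exact mul_le_mul_of_nonneg_left (g.1.norm_coe_le_norm x) (weight_pos k x).le

theorem continuous_WBUC (f : WBUC n k Y) : Continuous f := by
  obtain ⟨g, rfl⟩ := (NormedImage.equiv _ (mulWeightBUC_injective n k Y)).surjective f
  rw [NormedImage.incl_equiv]
  exact (continuous_weight k).smul g.1.continuous

/-- Evaluation of elements of `w BUC` at a point, a bounded linear map. -/
def evalWBUC (x : E n) : WBUC n k Y →L[ℂ] Y :=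
  LinearMap.mkContinuous
    ((LinearMap.proj x).comp (NormedImage.incl _ (mulWeightBUC_injective n k Y)))
    (weight k x) fun f => norm_WBUC_apply_le f x

theorem isFunctionRealization_WBUC (hk : 0 ≤ k) :
    IsFunctionRealization (translateWBUC hk) (fun f : WBUC n k Y => (f : E n → Y)) where
  poly := polyIntegrable_WBUC
  add f g := .of_forall fun x => by rw [map_add]; rfl
  smul c f := .of_forall fun x => by rw [map_smul]; rfl
  translate y f := .of_forall fun x => translateWBUC_apply hk y f x
  bound ψ := by
    obtain ⟨C, hC⟩ := norm_integral_smul_le_of_le_weight (Y := Y) k ψ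
    refine ⟨C, fun f hf => hC f 0 (fun _ => le_rfl) (integrable_zero _ _ _) (by simp)
      (.of_forall fun x => (norm_WBUC_apply_le f x).trans ?_)⟩
    refine mul_le_mul_of_nonneg_left ?_ (weight_pos k x).le
    simpa using hf
  injective f g h := NormedImage.incl_injective _ _
    ((Continuous.ae_eq_iff_eq volume (continuous_WBUC f) (continuous_WBUC g)).1 h)

end BUCSpace

/-! ### Continuous functions vanishing at infinity -/

section C0Space

variable {n : ℕ} {k : ℝ} {Y : Type*} [NormedAddCommGroup Y] [NormedSpace ℂ Y]

/-- The weighted translation of a continuous function vanishing at infinity. -/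
def translateC0 (hk : 0 ≤ k) (y : E n) (g : C₀(E n, Y)) : C₀(E n, Y) where
  toFun := weightedTranslate k y g
  continuous_toFun := continuous_weightedTranslate y g.continuous
  zero_at_infty' := by
    have h1 : Tendsto (fun x : E n => x - y) (cocompact (E n)) (cocompact (E n)) :=
      (Homeomorph.subRight y).isClosedEmbedding.tendsto_cocompact
    have h2 := ((zero_at_infty g).comp h1).norm.const_mul (weight k y)
    rw [norm_zero, mul_zero] at h2
    exact squeeze_zero_norm (norm_weightedTranslate_le hk y g) h2

theorem norm_translateC0_le (hk : 0 ≤ k) (y : E n) (g : C₀(E n, Y)) :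
    ‖translateC0 hk y g‖ ≤ weight k y * ‖g‖ := by
  rw [← ZeroAtInftyContinuousMap.norm_toBCF_eq_norm, ← ZeroAtInftyContinuousMap.norm_toBCF_eq_norm]
  refine (BoundedContinuousFunction.norm_le
    (mul_nonneg (weight_pos k y).le (norm_nonneg _))).2 fun x => ?_
  exact (norm_weightedTranslate_le hk y g x).trans
    (mul_le_mul_of_nonneg_left (g.toBCF.norm_coe_le_norm _) (weight_pos k y).le)

/-- The weighted translations as bounded operators on `C₀(ℝⁿ, Y)`. -/
def translateC0L (hk : 0 ≤ k) (y : E n) : C₀(E n, Y) →L[ℂ] C₀(E n, Y) :=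
  LinearMap.mkContinuous
    { toFun := translateC0 hk y
      map_add' := fun f g => ZeroAtInftyContinuousMap.ext fun x => weightedTranslate_add y f g x
      map_smul' := fun c f => ZeroAtInftyContinuousMap.ext fun x =>
        weightedTranslate_smul y c f x }
    (weight k y) (norm_translateC0_le hk y)

theorem isWeightedTranslation_C0 (hk : 0 ≤ k) :
    IsWeightedTranslation k (translateC0L hk : E n → C₀(E n, Y) →L[ℂ] C₀(E n, Y)) where
  map_zero := by
    ext g x
    exact congrFun (weightedTranslate_zero g) x
  map_add y z := by
    ext g x
    exact (congrFun (weightedTranslate_weightedTranslate y z g) x).symm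
  norm_le y := LinearMap.mkContinuous_norm_le _ (weight_pos k y).le _
  tendsto_zero g := by
    refine Metric.tendsto_nhds.2 fun ε hε => ?_
    filter_upwards [eventually_norm_weightedTranslate_sub_le hk
      (ZeroAtInftyContinuousMap.uniformContinuous g) g.toBCF.norm_coe_le_norm
      (by positivity : 0 < ε / 2)] with y hy
    rw [dist_eq_norm, ← ZeroAtInftyContinuousMap.norm_toBCF_eq_norm]
    exact ((BoundedContinuousFunction.norm_le (by positivity)).2 hy).trans_lt (by linarith)

/-- The translations on `w C₀(ℝⁿ, Y)`. -/
abbrev translateWC0 (hk : 0 ≤ k) (y : E n) : WC0 n k Y →L[ℂ] WC0 n k Y :=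
  NormedImage.conj _ (mulWeightC0_injective n k Y) (translateC0L hk y)

theorem translateWC0_apply (hk : 0 ≤ k) (y : E n) (f : WC0 n k Y) (x : E n) :
    translateWC0 hk y f x = f (x - y) := by
  obtain ⟨g, rfl⟩ := (NormedImage.equiv _ (mulWeightC0_injective n k Y)).surjective f
  rw [NormedImage.conj_equiv, NormedImage.incl_equiv, NormedImage.incl_equiv]
  exact weight_smul_weightedTranslate y g x

theorem norm_WC0_apply_le (f : WC0 n k Y) (x : E n) : ‖f x‖ ≤ weight k x * ‖f‖ := by
  obtain ⟨g, rfl⟩ := (NormedImage.equiv _ (mulWeightC0_injective n k Y)).surjective f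
  rw [NormedImage.incl_equiv, NormedImage.norm_equiv]
  change ‖weight k x • g x‖ ≤ _
  rw [norm_smul, Real.norm_of_nonneg (weight_pos k x).le]
  exact mul_le_mul_of_nonneg_left (g.toBCF.norm_coe_le_norm x) (weight_pos k x).le

theorem continuous_WC0 (f : WC0 n k Y) : Continuous f := by
  obtain ⟨g, rfl⟩ := (NormedImage.equiv _ (mulWeightC0_injective n k Y)).surjective f
  rw [NormedImage.incl_equiv]
  exact (continuous_weight k).smul g.continuous

/-- Evaluation of elements of `w C₀` at a point, a bounded linear map. -/
def evalWC0 (x : E n) : WC0 n k Y →L[ℂ] Y :=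
  LinearMap.mkContinuous
    ((LinearMap.proj x).comp (NormedImage.incl _ (mulWeightC0_injective n k Y)))
    (weight k x) fun f => norm_WC0_apply_le f x

theorem isFunctionRealization_WC0 (hk : 0 ≤ k) :
    IsFunctionRealization (translateWC0 hk) (fun f : WC0 n k Y => (f : E n → Y)) where
  poly := polyIntegrable_WC0
  add f g := .of_forall fun x => by rw [map_add]; rfl
  smul c f := .of_forall fun x => by rw [map_smul]; rfl
  translate y f := .of_forall fun x => translateWC0_apply hk y f x
  bound ψ := by
    obtain ⟨C, hC⟩ := norm_integral_smul_le_of_le_weight (Y := Y) k ψ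
    refine ⟨C, fun f hf => hC f 0 (fun _ => le_rfl) (integrable_zero _ _ _) (by simp)
      (.of_forall fun x => (norm_WC0_apply_le f x).trans ?_)⟩
    refine mul_le_mul_of_nonneg_left ?_ (weight_pos k x).le
    simpa using hf
  injective f g h := NormedImage.incl_injective _ _
    ((Continuous.ae_eq_iff_eq volume (continuous_WC0 f) (continuous_WC0 g)).1 h)

end C0Space

/-! ### `Lᵖ` spaces -/

section LpTranslation

variable {n : ℕ} {Y : Type*} [NormedAddCommGroup Y] {p : ℝ≥0∞}

theorem measurePreserving_sub_const (y : E n) :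
    MeasurePreserving (fun x : E n => x - y) volume volume :=
  measurePreserving_sub_right volume y

theorem memLp_comp_sub (y : E n) (g : Lp Y p (volume : Measure (E n))) :
    MemLp (fun x => g (x - y)) p volume :=
  (Lp.memLp g).comp_measurePreserving (measurePreserving_sub_const y)

theorem norm_toLp_comp_sub (y : E n) (g : Lp Y p (volume : Measure (E n))) :
    ‖(memLp_comp_sub y g).toLp _‖ = ‖g‖ := by
  rw [Lp.norm_toLp, Lp.norm_def]
  congr 1
  exact eLpNorm_comp_measurePreserving (Lp.aestronglyMeasurable g) (measurePreserving_sub_const y)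

variable [Fact (1 ≤ p)]

/-- Strong continuity of translations on `Lᵖ`, from the continuity of the action of `ℝⁿ` on the
domain. -/
theorem tendsto_toLp_comp_sub (hp : p ≠ ∞) (g : Lp Y p (volume : Measure (E n))) :
    Tendsto (fun y : E n => (memLp_comp_sub y g).toLp _) (𝓝 0) (𝓝 g) := by
  have : Fact (p ≠ ∞) := ⟨hp⟩
  have h1 : Continuous fun y : E n => DomAddAct.mk (-y) +ᵥ g :=
    (DomAddAct.continuous_mk.comp continuous_neg).vadd continuous_const
  have h2 := h1.tendsto 0
  have h3 : ∀ y : E n, DomAddAct.mk (-y) +ᵥ g = (memLp_comp_sub y g).toLp _ := by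
    intro y
    refine Lp.ext ?_
    filter_upwards [DomAddAct.vadd_Lp_ae_eq (DomAddAct.mk (-y)) g, (memLp_comp_sub y g).coeFn_toLp]
      with x hx1 hx2
    rw [hx1, hx2]
    simp [sub_eq_neg_add]
  simp_rw [h3] at h2
  have h4 : (memLp_comp_sub 0 g).toLp _ = g := by
    rw [← h3]
    simp
  rwa [h4] at h2

theorem integral_norm_rpow_le_one (hp : p ≠ ∞) {g : Lp Y p (volume : Measure (E n))}
    (hg : ‖g‖ ≤ 1) : ∫ x, ‖g x‖ ^ p.toReal ≤ 1 := by
  have hp0 : p ≠ 0 := (zero_lt_one.trans_le Fact.out).ne'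
  have hpr : 0 < p.toReal := ENNReal.toReal_pos hp0 hp
  have h0 : 0 ≤ ∫ x, ‖g x‖ ^ p.toReal := integral_nonneg fun x => by positivity
  rw [Lp.norm_def, (Lp.memLp g).eLpNorm_eq_integral_rpow_norm hp0 hp,
    ENNReal.toReal_ofReal (by positivity)] at hg
  by_contra! h
  exact absurd hg (not_le.2 (Real.one_lt_rpow h (by positivity)))

end LpTranslation

section LpSpace

variable {n : ℕ} {k : ℝ} {Y : Type*} [NormedAddCommGroup Y] [NormedSpace ℂ Y] {p : ℝ≥0∞}

theorem aestronglyMeasurable_weightedTranslate (y : E n) {g : E n → Y}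
    (hg : AEStronglyMeasurable g volume) :
    AEStronglyMeasurable (weightedTranslate k y g) volume :=
  (continuous_weight_ratio y).aestronglyMeasurable.smul
    (hg.comp_measurePreserving (measurePreserving_sub_const y))

theorem memLp_weightedTranslate (hk : 0 ≤ k) (y : E n) (g : Lp Y p (volume : Measure (E n))) :
    MemLp (weightedTranslate k y g) p volume :=
  MemLp.of_le_mul (memLp_comp_sub y g)
    (aestronglyMeasurable_weightedTranslate y (Lp.aestronglyMeasurable g))
    (.of_forall fun x => norm_weightedTranslate_le hk y g x)

theorem weightedTranslate_congr (y : E n) {g h : E n → Y} (hgh : g =ᵐ[volume] h) :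
    weightedTranslate k y g =ᵐ[volume] weightedTranslate k y h := by
  filter_upwards [(measurePreserving_sub_const y).quasiMeasurePreserving.ae_eq_comp hgh] with x hx
  simp only [weightedTranslate]
  rw [show g (x - y) = h (x - y) from hx]

/-- The weighted translation of an element of `Lᵖ`. -/
def translateLp (hk : 0 ≤ k) (y : E n) (g : Lp Y p (volume : Measure (E n))) :
    Lp Y p (volume : Measure (E n)) :=
  (memLp_weightedTranslate hk y g).toLp _

theorem coeFn_translateLp (hk : 0 ≤ k) (y : E n) (g : Lp Y p (volume : Measure (E n))) :
    translateLp hk y g =ᵐ[volume] weightedTranslate k y g :=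
  MemLp.coeFn_toLp _

theorem norm_translateLp_le (hk : 0 ≤ k) (y : E n) (g : Lp Y p (volume : Measure (E n))) :
    ‖translateLp hk y g‖ ≤ weight k y * ‖g‖ := by
  rw [← norm_toLp_comp_sub y g]
  refine Lp.norm_le_mul_norm_of_ae_le_mul ?_
  filter_upwards [coeFn_translateLp hk y g, (memLp_comp_sub y g).coeFn_toLp] with x h1 h2
  rw [h1, h2]
  exact norm_weightedTranslate_le hk y g x

theorem coeFn_mulWeightLp (g : Lp Y p (volume : Measure (E n))) :
    (mulWeightLp n k Y p g : E n → Y) =ᵐ[volume] fun x => weight k x • g x :=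
  AEEqFun.coeFn_mk (fun x => weight k x • g x)
    ((continuous_weight k).aestronglyMeasurable.smul (Lp.aestronglyMeasurable g))

variable [Fact (1 ≤ p)]

/-- The weighted translations as bounded operators on `Lᵖ(ℝⁿ, Y)`. -/
def translateLpL (hk : 0 ≤ k) (y : E n) :
    Lp Y p (volume : Measure (E n)) →L[ℂ] Lp Y p (volume : Measure (E n)) :=
  LinearMap.mkContinuous
    { toFun := translateLp hk y
      map_add' := fun f g => by
        refine Lp.ext ?_
        filter_upwards [coeFn_translateLp hk y (f + g), coeFn_translateLp hk y f,
          coeFn_translateLp hk y g, Lp.coeFn_add (translateLp hk y f) (translateLp hk y g),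
          weightedTranslate_congr (k := k) y (Lp.coeFn_add f g)] with x h1 h2 h3 h4 h5
        rw [h1, h4, Pi.add_apply, h2, h3, h5]
        exact weightedTranslate_add y f g x
      map_smul' := fun c f => by
        refine Lp.ext ?_
        filter_upwards [coeFn_translateLp hk y (c • f), coeFn_translateLp hk y f,
          Lp.coeFn_smul c (translateLp hk y f),
          weightedTranslate_congr (k := k) y (Lp.coeFn_smul c f)] with x h1 h2 h4 h5
        rw [h1, RingHom.id_apply, h4, Pi.smul_apply, h2, h5]
        exact weightedTranslate_smul y c f x }
    (weight k y) (norm_translateLp_le hk y)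

theorem isWeightedTranslation_Lp (hk : 0 ≤ k) (hp : p ≠ ∞) :
    IsWeightedTranslation k (translateLpL hk :
      E n → Lp Y p (volume : Measure (E n)) →L[ℂ] Lp Y p (volume : Measure (E n))) where
  map_zero := by
    refine ContinuousLinearMap.ext fun g => Lp.ext ?_
    filter_upwards [coeFn_translateLp hk 0 g] with x hx
    exact hx.trans (congrFun (weightedTranslate_zero (g : E n → Y)) x)
  map_add y z := by
    refine ContinuousLinearMap.ext fun g => Lp.ext ?_
    filter_upwards [coeFn_translateLp hk (y + z) g, coeFn_translateLp hk y (translateLp hk z g),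
      weightedTranslate_congr (k := k) y (coeFn_translateLp hk z g)] with x h1 h2 h3
    refine h1.trans (Eq.trans ?_ (h2.trans h3).symm)
    exact (congrFun (weightedTranslate_weightedTranslate y z (g : E n → Y)) x).symm
  norm_le y := LinearMap.mkContinuous_norm_le _ (weight_pos k y).le _
  tendsto_zero g := by
    have h1 : Tendsto (fun y : E n => (weight k y - 1) * ‖g‖) (𝓝 0) (𝓝 0) := by
      simpa using tendsto_weight_sub_one.mul_const ‖g‖
    have h2 : Tendsto (fun y : E n => translateLp hk y g - (memLp_comp_sub y g).toLp _) (𝓝 0)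
        (𝓝 0) := by
      refine squeeze_zero_norm (fun y => ?_) h1
      rw [← norm_toLp_comp_sub y g]
      refine Lp.norm_le_mul_norm_of_ae_le_mul ?_
      filter_upwards [coeFn_translateLp hk y g, (memLp_comp_sub y g).coeFn_toLp,
        Lp.coeFn_sub (translateLp hk y g) ((memLp_comp_sub y g).toLp _)] with x e1 e2 e3
      rw [e3, Pi.sub_apply, e1, e2]
      exact norm_weightedTranslate_sub_le hk y g x
    have h3 := h2.add (tendsto_toLp_comp_sub hp g)
    simp only [sub_add_cancel, zero_add] at h3
    exact h3

/-- The translations on `w Lᵖ(ℝⁿ, Y)`. -/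
abbrev translateWLp (hk : 0 ≤ k) (y : E n) : WLp n k Y p →L[ℂ] WLp n k Y p :=
  NormedImage.conj _ (mulWeightLp_injective n k Y p) (translateLpL hk y)

theorem translateWLp_ae_eq (hk : 0 ≤ k) (y : E n) (f : WLp n k Y p) :
    translateWLp hk y f =ᵐ[volume] fun x => f (x - y) := by
  obtain ⟨g, rfl⟩ := (NormedImage.equiv _ (mulWeightLp_injective n k Y p)).surjective f
  rw [NormedImage.conj_equiv, NormedImage.incl_equiv, NormedImage.incl_equiv]
  filter_upwards [coeFn_mulWeightLp (k := k) (translateLpL hk y g), coeFn_translateLp hk y g,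
    (measurePreserving_sub_const y).quasiMeasurePreserving.ae_eq_comp
      (coeFn_mulWeightLp (k := k) g)] with x h1 h2 h3
  have h2' : (translateLpL hk y g) x = weightedTranslate k y g x := h2
  rw [h1, h2', weight_smul_weightedTranslate]
  exact h3.symm

theorem isFunctionRealization_WLp (hk : 0 ≤ k) (hp : p ≠ ∞) :
    IsFunctionRealization (translateWLp hk) (fun f : WLp n k Y p => (f : E n → Y)) where
  poly := polyIntegrable_WLp hp
  add f g := by
    simp only [map_add]
    exact AEEqFun.coeFn_add _ _
  smul c f := by
    simp only [map_smul]
    exact AEEqFun.coeFn_smul _ _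
  translate y f := translateWLp_ae_eq hk y f
  bound ψ := by
    obtain ⟨C, hC⟩ := norm_integral_smul_le_of_le_weight (Y := Y) k ψ
    refine ⟨C, fun f hf => ?_⟩
    obtain ⟨g, rfl⟩ := (NormedImage.equiv _ (mulWeightLp_injective n k Y p)).surjective f
    rw [NormedImage.norm_equiv] at hf
    have hp1 : (1 : ℝ≥0∞) ≤ p := Fact.out
    have hp0 : p ≠ 0 := (zero_lt_one.trans_le hp1).ne'
    have hq : 1 ≤ p.toReal := by simpa using ENNReal.toReal_mono hp hp1
    refine hC _ (fun x => ‖g x‖ ^ p.toReal) (fun x => by positivity)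
      ((Lp.memLp g).integrable_norm_rpow hp0 hp) (integral_norm_rpow_le_one hp hf) ?_
    rw [NormedImage.incl_equiv]
    filter_upwards [coeFn_mulWeightLp (k := k) g] with x hx
    rw [hx, norm_smul, Real.norm_of_nonneg (weight_pos k x).le]
    refine mul_le_mul_of_nonneg_left ?_ (weight_pos k x).le
    -- `‖g x‖ ≤ 1 + ‖g x‖ ^ p`, which replaces Hölder's inequality.
    rcases le_total ‖g x‖ 1 with h | h
    · have : 0 ≤ ‖g x‖ ^ p.toReal := by positivity
      linarith
    · have := Real.rpow_le_rpow_of_exponent_le h hq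
      rw [Real.rpow_one] at this
      linarith
  injective f g h := NormedImage.incl_injective _ _ (AEEqFun.ext h)

end LpSpace

end WeightedHeat

end

theorem theorem2p1 (n : ℕ) (k : ℝ) (hk : 0 ≤ k)
    (Y : Type*) [NormedAddCommGroup Y] [NormedSpace ℂ Y] [CompleteSpace Y] :
    -- `X = BUC(ℝⁿ, Y)`
    (∃ G : ℂ → WBUC n k Y →L[ℂ] WBUC n k Y,
      (∀ ζ : ℂ, 0 < ζ.re → ∀ (f : WBUC n k Y) (x : E n),
        GaussConvExistsAt ζ f x ∧ G ζ f x = gaussConv ζ f x) ∧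
      IsHolomorphicC0Semigroup (Real.pi / 2) G ∧
      ∀ f h : WBUC n k Y, IsGeneratorAt (fun t : ℝ => G t) f h ↔ IsLaplacianAt distBUC f h) ∧
    -- `X = C₀(ℝⁿ, Y)`
    (∃ G : ℂ → WC0 n k Y →L[ℂ] WC0 n k Y,
      (∀ ζ : ℂ, 0 < ζ.re → ∀ (f : WC0 n k Y) (x : E n),
        GaussConvExistsAt ζ f x ∧ G ζ f x = gaussConv ζ f x) ∧
      IsHolomorphicC0Semigroup (Real.pi / 2) G ∧
      ∀ f h : WC0 n k Y, IsGeneratorAt (fun t : ℝ => G t) f h ↔ IsLaplacianAt distC0 f h) ∧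
    -- `X = Lᵖ(ℝⁿ, Y)`, `1 ≤ p < ∞`
    (∀ (p : ℝ≥0∞) [Fact (1 ≤ p)] (hp : p ≠ ∞),
      ∃ G : ℂ → WLp n k Y p →L[ℂ] WLp n k Y p,
        (∀ ζ : ℂ, 0 < ζ.re → ∀ f : WLp n k Y p,
          (∀ x : E n, GaussConvExistsAt ζ f x) ∧ ∀ᵐ x : E n, G ζ f x = gaussConv ζ f x) ∧
        IsHolomorphicC0Semigroup (Real.pi / 2) G ∧
        ∀ f h : WLp n k Y p,
          IsGeneratorAt (fun t : ℝ => G t) f h ↔ IsLaplacianAt (distLp hp) f h) := by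
  refine ⟨?_, ?_, fun p _ hp => ?_⟩
  · have hU := (isWeightedTranslation_BUC (n := n) (Y := Y) hk).normedImage _
      (mulWeightBUC_injective n k Y)
    have hr := isFunctionRealization_WBUC (n := n) (Y := Y) hk
    exact ⟨hU.gaussOp, fun ζ hζ f x => ⟨(polyIntegrable_WBUC f).gaussConvExistsAt hζ x,
      hU.apply_gaussOp hζ f (evalWBUC x) fun y => translateWBUC_apply hk y f x⟩,
      hU.isHolomorphicC0Semigroup hk, hr.isGeneratorAt_iff hU hk⟩
  · have hU := (isWeightedTranslation_C0 (n := n) (Y := Y) hk).normedImage _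
      (mulWeightC0_injective n k Y)
    have hr := isFunctionRealization_WC0 (n := n) (Y := Y) hk
    exact ⟨hU.gaussOp, fun ζ hζ f x => ⟨(polyIntegrable_WC0 f).gaussConvExistsAt hζ x,
      hU.apply_gaussOp hζ f (evalWC0 x) fun y => translateWC0_apply hk y f x⟩,
      hU.isHolomorphicC0Semigroup hk, hr.isGeneratorAt_iff hU hk⟩
  · have hU := (isWeightedTranslation_Lp (n := n) (Y := Y) hk hp).normedImage _
      (mulWeightLp_injective n k Y p)
    have hr := isFunctionRealization_WLp (n := n) (Y := Y) hk hp
    exact ⟨hU.gaussOp, fun ζ hζ f => ⟨(polyIntegrable_WLp hp f).gaussConvExistsAt hζ,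
      hr.ae_eq_gaussConv hU hζ f⟩,
      hU.isHolomorphicC0Semigroup hk, hr.isGeneratorAt_iff hU hk⟩
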